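/- All graphs are finite, simple and undirected. The diameter of a graph is the maximum distance between two of its vertices, and it is infinite if the graph is disconnected. A graph $G$ is $F$-subgraph-free if it has no subgraph (induced or not) isomorphic to $F$. The treedepth of $G$ is the minimum height (number of vertices on a longest root-to-leaf path) of a rooted forest $T$ with $V(T)=V(G)$ such that for every edge $uv$ of $G$ the vertices $u$ and $v$ lie on a common root-to-leaf path of $T$. A subdivided star is a graph obtained from a star with $k\ge 3$ pendant vertices by subdividing its edges, each an arbitrary number of times (possibly zero); equivalently, it is a tree with exactly one vertex of degree at least $3$. For an integer $\ell\ge 1$, let $H_2^\ell$ be the tree obtained from a path $(a,m,b)$ by attaching to each of its two end-vertices $a$ and $b$ two pendant paths of length $\ell$ (so it has $3+4\ell$ vertices). Theorem. Let $F$ be a graph. There is a constant $c$ (depending only on $F$) such that every $F$-subgraph-free graph of diameter at most $4$ has treedepth at most $c$ if and only if $F$ is a subgraph of some subdivided star or $F$ is a subgraph of $H_2^\ell$ for some integer $\ell\ge 1$. -/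

import Mathlib

open scoped SimpleGraph

/-- A rooted forest on the vertex set `V`, given by its parent function (`none` at the roots).
The two laws determine `depth v` as the number of vertices on the path from the root of the
component of `v` down to `v`; that such a function exists says exactly that iterating `parent`
always ends in a root. -/
structure RootedForest (V : Type*) where
  parent : V → Option V
  depth : V → ℕ
  depth_root : ∀ v, parent v = none → depth v = 1
  depth_child : ∀ v u, parent v = some u → depth v = depth u + 1

namespace RootedForest

variable {V : Type*}

/-- `u` lies on the path from the root to `v` (possibly `u = v`). -/
def IsAncestor (T : RootedForest V) (u v : V) : Prop :=
  Relation.ReflTransGen (fun a b => T.parent b = some a) u v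

/-- The height: the largest number of vertices on a root-to-leaf path. -/
def height [Fintype V] (T : RootedForest V) : ℕ := Finset.univ.sup T.depth

/-- `T` is an elimination forest of `G`: the two ends of every edge of `G` lie on a common
root-to-leaf path of `T`, i.e. one of them is an ancestor of the other. -/
def IsElimination (T : RootedForest V) (G : SimpleGraph V) : Prop :=
  ∀ u v, G.Adj u v → T.IsAncestor u v ∨ T.IsAncestor v u

end RootedForest

/-- The treedepth of a finite graph: the minimum height of an elimination forest. -/
noncomputable def treedepth {V : Type*} [Fintype V] (G : SimpleGraph V) : ℕ :=
  sInf {h | ∃ T : RootedForest V, T.IsElimination G ∧ T.height = h}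

/-- The subdivided star with `k` legs, the `i`-th having `len i` edges: the star with `k` pendant
vertices whose `i`-th edge is subdivided `len i - 1` times. `none` is the centre and
`some ⟨i, j⟩` the vertex of the `i`-th leg at distance `j + 1` from the centre. -/
def subdividedStar (k : ℕ) (len : Fin k → ℕ) : SimpleGraph (Option (Σ i : Fin k, Fin (len i))) :=
  SimpleGraph.fromRel fun x y =>
    match x, y with
    | none, some b => (b.2 : ℕ) = 0
    | some a, some b => a.1 = b.1 ∧ (b.2 : ℕ) = a.2 + 1
    | _, none => False

/-- The subdivided `H`-graph with a central path of `i` edges, to each of whose two ends two legs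
of `l` edges are attached. `Sum.inl j` is the `j`-th vertex of the central path. In
`Sum.inr (s, t, j)`, `s` says at which end of the central path the leg is attached (`false`: at the
vertex `0`, `true`: at the vertex `i`), `t` tells the two legs at this end apart, and the vertex is
at distance `j + 1` from the central path. -/
def subdividedH (i l : ℕ) : SimpleGraph (Fin (i + 1) ⊕ (Bool × Bool × Fin l)) :=
  SimpleGraph.fromRel fun x y =>
    match x, y with
    | Sum.inl a, Sum.inl b => (b : ℕ) = a + 1
    | Sum.inl a, Sum.inr (s, _, j) => (a : ℕ) = (if s then i else 0) ∧ (j : ℕ) = 0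
    | Sum.inr (s, t, j), Sum.inr (s', t', j') => s = s' ∧ t = t' ∧ (j' : ℕ) = j + 1
    | Sum.inr _, Sum.inl _ => False

/-! Treedepth and the order of a longest path bound each other. A rooted forest whose parent links
are edges of `G` and whose depth sum is maximal is an elimination forest, and its branches are paths
of `G`; conversely a path on 2^c vertices forces treedepth above c. So the question is which `F`
occur in every graph of diameter at most 4 that has a sufficiently long path.

Necessity comes from two families of such graphs. In `subdividedComplete` no two adjacent vertices
both have degree at least 3. In `hubGraph (sparse m)`, a path plus a hub, there is no cycle of
length m + 2. Hence `F` is acyclic, no edge of `F` joins two branching vertices, and deleting at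
most one vertex h turns `F` into a union of paths, each with at most one neighbour of h. If h has
degree at most 2, `F` fits into an H-graph; otherwise the neighbours of h have degree at most 2, so
each is an end of its path, and `F` fits into a subdivided star.

For sufficiency, a long path is cut into many disjoint segments. A vertex is rich if long legs start
from it outside any small forbidden set; a rich vertex is the centre of a large subdivided star. If
u is not rich, a small set S blocks its legs, so nearly all short walks from u to segment centres
pass through S, and by pigeonhole some vertex of S is strictly closer to many centres
(`exists_closer`). Iterating from distance 4 down to 0 yields a rich vertex, hence the star.

If the H-graph is absent, few segments lie within distance 2 of any vertex. Two rounds of the same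
descent then show that every vertex that is not rich has a rich neighbour. Distinct rich vertices
have no common neighbour, and there are four pairwise distinct, nonadjacent ones. Diameter 4
produces an edge between the stars of two of them and another for the other two; a short walk
between these edges then exposes three rich vertices placed so that the H-graph appears. -/

/-! ### Rooted forests and paths -/

namespace RootedForest

variable {V : Type*} (T : RootedForest V)

theorem depth_pos (v : V) : 1 ≤ T.depth v := by
  rcases h : T.parent v with _ | u
  · exact (T.depth_root v h).ge
  · rw [T.depth_child v u h]; omega

theorem IsAncestor.depth_le {T : RootedForest V} {u v : V} (h : T.IsAncestor u v) :
    T.depth u ≤ T.depth v := by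
  induction h with
  | refl => exact le_rfl
  | tail _ h ih => rw [T.depth_child _ _ h]; omega

theorem IsAncestor.eq_of_depth_le {T : RootedForest V} {u v : V} (h : T.IsAncestor u v)
    (hd : T.depth v ≤ T.depth u) : u = v := by
  rcases Relation.ReflTransGen.cases_tail h with h | ⟨w, hw, h⟩
  · exact h.symm
  · have : T.depth u ≤ T.depth w := IsAncestor.depth_le hw
    rw [T.depth_child _ _ h] at hd
    omega

theorem isAncestor_iff_of_parent {u v w : V} (h : T.parent w = some v) (hne : u ≠ w) :
    T.IsAncestor u w ↔ T.IsAncestor u v := by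
  constructor
  · intro hu
    rcases Relation.ReflTransGen.cases_tail hu with h' | ⟨x, hx, h'⟩
    · exact absurd h'.symm hne
    · rw [h] at h'
      cases h'
      exact hx
  · exact fun hu => Relation.ReflTransGen.tail hu h

theorem IsAncestor.total {T : RootedForest V} {u v w : V} (hu : T.IsAncestor u w)
    (hv : T.IsAncestor v w) : T.IsAncestor u v ∨ T.IsAncestor v u := by
  have hr : Relator.RightUnique (Function.swap fun a b => T.parent b = some a) := by
    intro a b c hb hc
    simp only [Function.swap] at hb hc
    rw [hb] at hc
    exact Option.some_injective _ hc
  rcases Relation.ReflTransGen.total_of_right_unique hr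
    (Relation.reflTransGen_swap.mpr hu) (Relation.reflTransGen_swap.mpr hv) with h | h
  · exact Or.inr (Relation.reflTransGen_swap.mp h)
  · exact Or.inl (Relation.reflTransGen_swap.mp h)

@[refl] theorem IsAncestor.refl (v : V) : T.IsAncestor v v := Relation.ReflTransGen.refl

open Classical in
/-- Move the subtree below `u` so that its root `u` becomes a child of `v`. -/
noncomputable def rehang (u v : V) (huv : ¬ T.IsAncestor u v) : RootedForest V :=
  { parent := Function.update T.parent u (some v)
    depth := fun w => if T.IsAncestor u w then T.depth w + (T.depth v + 1) - T.depth u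
      else T.depth w
    depth_root := by
      intro w hw
      have hwu : w ≠ u := by rintro rfl; simp at hw
      rw [Function.update_of_ne hwu] at hw
      rw [if_neg, T.depth_root w hw]
      intro h
      rcases Relation.ReflTransGen.cases_tail h with h' | ⟨x, -, h'⟩
      · exact hwu h'
      · rw [hw] at h'; cases h'
    depth_child := by
      intro w x hw
      by_cases hwu : w = u
      · subst hwu
        simp only [Function.update_self, Option.some.injEq] at hw
        subst hw
        rw [if_neg huv, if_pos (IsAncestor.refl T _)]
        omega
      · rw [Function.update_of_ne hwu] at hw
        simp only [T.isAncestor_iff_of_parent hw (Ne.symm hwu)]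
        split_ifs with h
        · have := h.depth_le
          rw [T.depth_child _ _ hw]
          omega
        · exact T.depth_child _ _ hw }

open Classical in
theorem rehang_depth (u v : V) (huv : ¬ T.IsAncestor u v) (w : V) :
    (T.rehang u v huv).depth w = if T.IsAncestor u w then T.depth w + (T.depth v + 1) - T.depth u
      else T.depth w := rfl

open Classical in
theorem rehang_parent (u v : V) (huv : ¬ T.IsAncestor u v) :
    (T.rehang u v huv).parent = Function.update T.parent u (some v) := rfl

end RootedForest

/-- `p 0, …, p (n - 1)` are the consecutive vertices of a path of `G`. -/
structure IsPathSeq {V : Type*} (G : SimpleGraph V) (n : ℕ) (p : ℕ → V) : Prop where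
  adj : ∀ i, i + 1 < n → G.Adj (p i) (p (i + 1))
  inj : ∀ i < n, ∀ j < n, p i = p j → i = j

theorem IsPathSeq.mono {V : Type*} {G : SimpleGraph V} {n m : ℕ} {p : ℕ → V}
    (hp : IsPathSeq G n p) (h : m ≤ n) : IsPathSeq G m p :=
  ⟨fun i hi => hp.adj i (by omega), fun i hi j hj => hp.inj i (by omega) j (by omega)⟩

theorem IsPathSeq.shift {V : Type*} {G : SimpleGraph V} {n m : ℕ} {p : ℕ → V}
    (hp : IsPathSeq G n p) (k : ℕ) (h : m + k ≤ n) : IsPathSeq G m fun i => p (i + k) :=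
  ⟨fun i hi => by simpa [add_right_comm] using hp.adj (i + k) (by omega),
    fun i hi j hj hij => by have := hp.inj (i + k) (by omega) (j + k) (by omega) hij; omega⟩

/-! ### Treedepth against the order of a longest path -/

section Treedepth

variable {V : Type*} {G : SimpleGraph V}

/-- The path climbs from `v` to its root. The depth drops by one at each step, which is what makes
its vertices distinct. -/
theorem RootedForest.exists_isPathSeq (T : RootedForest V)
    (hT : ∀ v u, T.parent v = some u → G.Adj v u) (v : V) :
    ∃ p, IsPathSeq G (T.depth v) p ∧ p 0 = v ∧ ∀ i < T.depth v, T.depth (p i) + i = T.depth v := by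
  induction hd : T.depth v generalizing v with
  | zero => have := T.depth_pos v; omega
  | succ n ih =>
    rcases h : T.parent v with _ | u
    · have := T.depth_root v h
      obtain rfl : n = 0 := by omega
      refine ⟨fun _ => v, ⟨fun i hi => by omega, fun i hi j hj _ => by omega⟩, rfl, fun i hi => ?_⟩
      · obtain rfl : i = 0 := by omega
        simpa using hd
    · have hdc := T.depth_child v u h
      obtain ⟨p, hp, hp0, hpd⟩ := ih u (by omega)
      refine ⟨fun i => if i = 0 then v else p (i - 1), ⟨?_, ?_⟩, rfl, ?_⟩
      · rintro (_ | i) hi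
        · simpa [hp0] using hT v u h
        · simpa using hp.adj i (by omega)
      · have key : ∀ i < n + 1, T.depth (if i = 0 then v else p (i - 1)) + i = n + 1 := by
          rintro (_ | i) hi
          · simpa using hd
          · have := hpd i (by omega)
            simp only [Nat.add_eq_zero_iff, one_ne_zero, and_false, if_false,
              Nat.add_sub_cancel]
            omega
        intro i hi j hj hij
        have h1 := key i hi
        have h2 := key j hj
        rw [hij] at h1
        omega
      · rintro (_ | i) hi
        · simpa using hd
        · have := hpd i (by omega)
          simp only [Nat.add_eq_zero_iff, one_ne_zero, and_false, if_false, Nat.add_sub_cancel]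
          omega

variable [Fintype V]

/-- A rooted spanning forest of `G` with the largest sum of depths is an elimination forest. -/
theorem exists_isElimination_adj (G : SimpleGraph V) :
    ∃ T : RootedForest V, T.IsElimination G ∧ ∀ v u, T.parent v = some u → G.Adj v u := by
  classical
  let S : Set ℕ := {n | ∃ T : RootedForest V,
    (∀ v u, T.parent v = some u → G.Adj v u) ∧ ∑ v, T.depth v = n}
  have hne : S.Nonempty := ⟨_, ⟨fun _ => none, fun _ => 1, fun _ _ => rfl, by simp⟩, by simp, rfl⟩
  have hbd : BddAbove S := by
    -- The path from `v` up to its root has `T.depth v` distinct vertices, so no depth exceeds the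
    -- order of the graph.
    refine ⟨∑ _v : V, Fintype.card V, ?_⟩
    rintro n ⟨T, hT, rfl⟩
    refine Finset.sum_le_sum fun v _ => ?_
    obtain ⟨p, hp, -, -⟩ := T.exists_isPathSeq hT v
    have := Finset.card_le_card_of_injOn (s := Finset.range (T.depth v)) (t := Finset.univ) p
      (by simp) (fun i hi j hj => hp.inj i (by simpa using hi) j (by simpa using hj))
    simpa using this
  obtain ⟨T, hT, hsum⟩ := Nat.sSup_mem hne hbd
  refine ⟨T, ?_, hT⟩
  have main : ∀ u v, G.Adj u v → T.depth u ≤ T.depth v → T.IsAncestor u v := by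
    intro u v huv hd
    by_contra hanc
    have hmem : ∑ w, (T.rehang u v hanc).depth w ∈ S := by
      refine ⟨T.rehang u v hanc, fun w x hw => ?_, rfl⟩
      rw [RootedForest.rehang_parent] at hw
      by_cases hwu : w = u
      · subst hwu
        simp only [Function.update_self, Option.some.injEq] at hw
        exact hw ▸ huv
      · rw [Function.update_of_ne hwu] at hw
        exact hT _ _ hw
    -- As `u` is no deeper than `v`, hanging it below `v` moves its whole subtree down by at least
    -- one level.
    have hlt : ∑ w, T.depth w < ∑ w, (T.rehang u v hanc).depth w := by
      refine Finset.sum_lt_sum (fun w _ => ?_) ⟨u, Finset.mem_univ _, ?_⟩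
      · rw [RootedForest.rehang_depth]
        split_ifs with h
        · omega
        · exact le_rfl
      · rw [RootedForest.rehang_depth]
        rw [if_pos (RootedForest.IsAncestor.refl T _)]
        omega
    have := le_csSup hbd hmem
    omega
  intro u v huv
  rcases le_total (T.depth u) (T.depth v) with h | h
  · exact Or.inl (main u v huv h)
  · exact Or.inr (main v u huv.symm h)

theorem treedepth_le_of_forall_not_isPathSeq {n : ℕ} (h : ∀ p, ¬ IsPathSeq G (n + 1) p) :
    treedepth G ≤ n := by
  obtain ⟨T, hT, hadj⟩ := exists_isElimination_adj G
  have hle : treedepth G ≤ T.height := Nat.sInf_le ⟨T, hT, rfl⟩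
  refine hle.trans (Finset.sup_le fun v _ => ?_)
  by_contra! hv
  obtain ⟨p, hp, -, -⟩ := T.exists_isPathSeq hadj v
  exact h p (hp.mono hv)

/-- An edge can leave the subtree of `r` only towards a proper ancestor of `r`, and that is
shallower than `r`. -/
theorem RootedForest.IsElimination.isAncestor_of_adj {V : Type*} {G : SimpleGraph V}
    {T : RootedForest V} (hT : T.IsElimination G) {r u v : V} (huv : G.Adj u v)
    (hu : T.IsAncestor r u) (hd : T.depth r ≤ T.depth v) : T.IsAncestor r v := by
  rcases hT u v huv with h | h
  · exact Relation.ReflTransGen.trans hu h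
  · rcases hu.total h with h' | h'
    · exact h'
    · rw [h'.eq_of_depth_le hd]

/-- Among the `2 ^ k` vertices of a path, all of depth at least `j`, one has depth at least
`j + k`. -/
theorem RootedForest.IsElimination.exists_depth_ge {V : Type*} {G : SimpleGraph V}
    {T : RootedForest V} (hT : T.IsElimination G) (k j : ℕ) (p : ℕ → V)
    (hp : IsPathSeq G (2 ^ k) p) (hj : ∀ i < 2 ^ k, j ≤ T.depth (p i)) :
    ∃ i < 2 ^ k, j + k ≤ T.depth (p i) := by
  induction k generalizing j p with
  | zero => exact ⟨0, by simp, by simpa using hj 0 (by simp)⟩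
  | succ k ih =>
    have h2 : 2 ^ (k + 1) = 2 ^ k + 2 ^ k := by ring
    -- A shallowest vertex of the path is an ancestor of all its vertices, so the others are
    -- strictly deeper. The half of the path that misses it goes into the induction, with `j + 1`
    -- for `j`.
    obtain ⟨m, hm, hmin⟩ := Finset.exists_min_image (Finset.range (2 ^ (k + 1)))
      (fun i => T.depth (p i)) ⟨0, by simp⟩
    simp only [Finset.mem_range] at hm hmin
    have hup : ∀ d, m + d < 2 ^ (k + 1) → T.IsAncestor (p m) (p (m + d)) := by
      intro d
      induction d with
      | zero => exact fun _ => Relation.ReflTransGen.refl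
      | succ d ihd =>
        intro hd
        exact hT.isAncestor_of_adj (hp.adj (m + d) hd) (ihd (by omega)) (hmin _ hd)
    have hdown : ∀ d ≤ m, T.IsAncestor (p m) (p (m - d)) := by
      intro d
      induction d with
      | zero => exact fun _ => Relation.ReflTransGen.refl
      | succ d ihd =>
        intro hd
        have := (hp.adj (m - (d + 1)) (by omega)).symm
        rw [show m - (d + 1) + 1 = m - d by omega] at this
        exact hT.isAncestor_of_adj this (ihd (by omega)) (hmin _ (by omega))
    have hanc : ∀ i < 2 ^ (k + 1), T.IsAncestor (p m) (p i) := by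
      intro i hi
      rcases le_total m i with h | h
      · have := hup (i - m) (by omega)
        rwa [show m + (i - m) = i by omega] at this
      · have := hdown (m - i) (by omega)
        rwa [show m - (m - i) = i by omega] at this
    have hlt : ∀ i < 2 ^ (k + 1), i ≠ m → j + 1 ≤ T.depth (p i) := by
      intro i hi him
      have h1 := hj m hm
      by_contra! hcon
      have := (hanc i hi).eq_of_depth_le (by omega)
      exact him (hp.inj i hi m hm this.symm)
    rcases lt_or_ge m (2 ^ k) with h | h
    · obtain ⟨i, hi, hi'⟩ := ih (j + 1) (fun i => p (i + 2 ^ k))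
        (hp.shift (2 ^ k) (by omega))
        (fun i hi => hlt _ (by omega) (by omega))
      exact ⟨i + 2 ^ k, by omega, by omega⟩
    · obtain ⟨i, hi, hi'⟩ := ih (j + 1) p
        (hp.mono (by omega))
        (fun i hi => hlt _ (by omega) (by omega))
      exact ⟨i, by omega, by omega⟩

theorem lt_treedepth_of_isPathSeq {c n : ℕ} {p : ℕ → V} (hp : IsPathSeq G n p) (hn : 2 ^ c ≤ n) :
    c < treedepth G := by
  obtain ⟨T₀, hT₀, -⟩ := exists_isElimination_adj G
  obtain ⟨T, hT, hh⟩ : ∃ T : RootedForest V, T.IsElimination G ∧ T.height = treedepth G :=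
    Nat.sInf_mem (s := {h | ∃ T : RootedForest V, T.IsElimination G ∧ T.height = h})
      ⟨_, T₀, hT₀, rfl⟩
  obtain ⟨i, -, hi⟩ := hT.exists_depth_ge c 1 p
    (hp.mono hn) (fun i _ => T.depth_pos _)
  have : T.depth (p i) ≤ T.height := Finset.le_sup (f := T.depth) (Finset.mem_univ _)
  omega

end Treedepth

/-! ### Two families of diameter at most 4 with long paths -/

section Obstructions

/-- The incidence graph between the elements of `Fin n` and the ordered pairs of them: the complete
graph with every edge doubled and subdivided once, with a pendant vertex attached to each vertex. -/
def subdividedComplete (n : ℕ) : SimpleGraph (Fin n ⊕ Fin n × Fin n) where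
  Adj
    | Sum.inl i, Sum.inr p => i = p.1 ∨ i = p.2
    | Sum.inr p, Sum.inl i => i = p.1 ∨ i = p.2
    | _, _ => False
  symm := ⟨by rintro (i | p) (j | q) <;> simp⟩
  loopless := ⟨by rintro (i | p) <;> simp⟩

/-- A path `some 0, …, some L` and a hub `none` adjacent to the path vertices in `D`. -/
def hubGraph (D : ℕ → Prop) (L : ℕ) : SimpleGraph (Option (Fin (L + 1))) where
  Adj
    | none, some b => D b
    | some a, none => D a
    | some a, some b => (a : ℕ) + 1 = b ∨ (b : ℕ) + 1 = a
    | none, none => False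
  symm := ⟨by rintro (_ | a) (_ | b) <;> simp; omega⟩
  loopless := ⟨by rintro (_ | a) <;> simp⟩

theorem subdividedComplete_ediam_le (n : ℕ) : (subdividedComplete n).ediam ≤ 4 := by
  refine SimpleGraph.ediam_le_of_edist_le ?_
  have toInl : ∀ x, ∃ i, ∃ p : (subdividedComplete n).Walk x (Sum.inl i), p.length ≤ 1 := by
    rintro (i | ⟨i, j⟩)
    · exact ⟨i, .nil, by simp⟩
    · have h : (subdividedComplete n).Adj (Sum.inr (i, j)) (Sum.inl i) := Or.inl rfl
      exact ⟨i, .cons h .nil, by simp⟩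
  intro x y
  obtain ⟨i, p, hp⟩ := toInl x
  obtain ⟨j, q, hq⟩ := toInl y
  have h1 : (subdividedComplete n).Adj (Sum.inl i) (Sum.inr (i, j)) := Or.inl rfl
  have h2 : (subdividedComplete n).Adj (Sum.inr (i, j)) (Sum.inl j) := Or.inr rfl
  refine ((p.append (.cons h1 (.cons h2 q.reverse))).edist_le).trans ?_
  simp only [SimpleGraph.Walk.length_append, SimpleGraph.Walk.length_cons,
    SimpleGraph.Walk.length_reverse]
  exact_mod_cast (by omega : p.length + (q.length + 1 + 1) ≤ 4)

theorem subdividedComplete_exists_isPathSeq (n : ℕ) :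
    ∃ p, IsPathSeq (subdividedComplete (n + 1)) (2 * n + 1) p := by
  -- The path 0, (0, 1), 1, (1, 2), …, n.
  refine ⟨fun i => if i % 2 = 0 then Sum.inl (Fin.ofNat (n + 1) (i / 2)) else
    Sum.inr (Fin.ofNat (n + 1) (i / 2), Fin.ofNat (n + 1) (i / 2 + 1)), ⟨fun i hi => ?_, ?_⟩⟩
  · rcases Nat.even_or_odd' i with ⟨k, rfl | rfl⟩
    · have h1 : (2 * k + 1) % 2 = 1 := by omega
      have h2 : (2 * k + 1) / 2 = k := by omega
      simp [h1, h2, subdividedComplete]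
    · have h1 : (2 * k + 1) % 2 = 1 := by omega
      have h2 : (2 * k + 1) / 2 = k := by omega
      have h3 : (2 * k + 1 + 1) % 2 = 0 := by omega
      have h4 : (2 * k + 1 + 1) / 2 = k + 1 := by omega
      simp [h1, h2, h3, h4, subdividedComplete]
  · intro i hi j hj hij
    have key : ∀ a b : ℕ, a < n + 1 → b < n + 1 → Fin.ofNat (n + 1) a = Fin.ofNat (n + 1) b →
        a = b := by
      intro a b ha hb hab
      have := congrArg Fin.val hab
      simpa [Nat.mod_eq_of_lt ha, Nat.mod_eq_of_lt hb] using this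
    split_ifs at hij with h1 h2 h2
    · have := key (i / 2) (j / 2) (by omega) (by omega) (Sum.inl_injective hij)
      omega
    · have := key (i / 2) (j / 2) (by omega) (by omega) (Prod.ext_iff.mp (Sum.inr_injective hij)).1
      omega

/-- One end of every edge is a pair, and a pair is adjacent only to its coordinates. -/
theorem subdividedComplete_not_branching {n : ℕ} {x y : Fin n ⊕ Fin n × Fin n}
    (hxy : (subdividedComplete n).Adj x y) :
    (∀ a b c, (subdividedComplete n).Adj x a → (subdividedComplete n).Adj x b →
      (subdividedComplete n).Adj x c → a = b ∨ a = c ∨ b = c) ∨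
    (∀ a b c, (subdividedComplete n).Adj y a → (subdividedComplete n).Adj y b →
      (subdividedComplete n).Adj y c → a = b ∨ a = c ∨ b = c) := by
  have key : ∀ p : Fin n × Fin n, ∀ a b c, (subdividedComplete n).Adj (Sum.inr p) a →
      (subdividedComplete n).Adj (Sum.inr p) b → (subdividedComplete n).Adj (Sum.inr p) c →
      a = b ∨ a = c ∨ b = c := by
    rintro p (a | a) (b | b) (c | c) <;> simp only [subdividedComplete, Sum.inl.injEq] <;> grind
  rcases x with i | p
  · rcases y with j | q
    · exact hxy.elim
    · exact Or.inr (key q)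
  · exact Or.inl (key p)

theorem hubGraph_ediam_le {D : ℕ → Prop} {L : ℕ}
    (h : ∀ a ≤ L, ∃ b ≤ L, D b ∧ (a = b ∨ a + 1 = b ∨ b + 1 = a)) :
    (hubGraph D L).ediam ≤ 4 := by
  refine SimpleGraph.ediam_le_of_edist_le ?_
  have toHub : ∀ x, ∃ p : (hubGraph D L).Walk x none, p.length ≤ 2 := by
    rintro (_ | a)
    · exact ⟨.nil, by simp⟩
    · obtain ⟨b, hb, hD, hab⟩ := h a (by omega)
      have h1 : (hubGraph D L).Adj (some ⟨b, by omega⟩) none := hD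
      rcases eq_or_ne (a : ℕ) b with rfl | hne
      · exact ⟨.cons h1 .nil, by simp⟩
      · have h2 : (hubGraph D L).Adj (some a) (some ⟨b, by omega⟩) := by
          change (a : ℕ) + 1 = b ∨ b + 1 = (a : ℕ)
          omega
        exact ⟨.cons h2 (.cons h1 .nil), by simp⟩
  intro x y
  obtain ⟨p, hp⟩ := toHub x
  obtain ⟨q, hq⟩ := toHub y
  refine ((p.append q.reverse).edist_le).trans ?_
  simp only [SimpleGraph.Walk.length_append, SimpleGraph.Walk.length_reverse]
  exact_mod_cast (by omega : p.length + q.length ≤ 4)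

theorem hubGraph_exists_isPathSeq (D : ℕ → Prop) (L : ℕ) :
    ∃ p, IsPathSeq (hubGraph D L) (L + 1) p := by
  refine ⟨fun i => some (Fin.ofNat (L + 1) i), ⟨fun i hi => ?_, fun i hi j hj hij => ?_⟩⟩
  · simp only [hubGraph, Fin.ofNat]
    rw [Nat.mod_eq_of_lt hi, Nat.mod_eq_of_lt (by omega)]
    exact Or.inl rfl
  · have := congrArg Fin.val (Option.some_injective _ hij)
    simpa [Nat.mod_eq_of_lt hi, Nat.mod_eq_of_lt hj] using this

/-- An injective sequence of integers with steps `±1` is monotone. -/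
theorem eq_add_or_eq_sub_of_injective_steps (a : ℕ → ℤ) (n : ℕ)
    (hstep : ∀ i < n, a (i + 1) = a i + 1 ∨ a i = a (i + 1) + 1)
    (hinj : ∀ i ≤ n, ∀ j ≤ n, a i = a j → i = j) :
    (∀ i ≤ n, a i = a 0 + i) ∨ (∀ i ≤ n, a i = a 0 - i) := by
  induction n with
  | zero => exact Or.inl fun i hi => by obtain rfl : i = 0 := by omega
                                        simp
  | succ n ih =>
    have hs := hstep n (by omega)
    rcases n with _ | n
    · rcases hs with h | h
      · left
        intro i hi
        interval_cases i
        · simp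
        · simpa using h
      · right
        intro i hi
        interval_cases i
        · simp
        · simp only [zero_add] at h
          push_cast
          omega
    · have hne : a (n + 1 + 1) ≠ a n := fun h => by
        have := hinj _ le_rfl n (by omega) h
        omega
      rcases ih (fun i hi => hstep i (by omega))
        (fun i hi j hj => hinj i (by omega) j (by omega)) with h | h
      · left
        intro i hi
        rcases Nat.lt_or_ge i (n + 2) with h' | h'
        · exact h i (by omega)
        · obtain rfl : i = n + 1 + 1 := by omega
          have h1 := h n (by omega)
          have h2 := h (n + 1) le_rfl
          push_cast at h2 ⊢
          omega
      · right
        intro i hi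
        rcases Nat.lt_or_ge i (n + 2) with h' | h'
        · exact h i (by omega)
        · obtain rfl : i = n + 1 + 1 := by omega
          have h1 := h n (by omega)
          have h2 := h (n + 1) le_rfl
          push_cast at h2 ⊢
          omega

/-- The position on the path of a vertex of `hubGraph`. -/
def hubGraphPos {L : ℕ} (x : Option (Fin (L + 1))) : ℤ := x.elim 0 fun a => (a : ℕ)

theorem hubGraphPos_inj {L : ℕ} {x y : Option (Fin (L + 1))} (hx : x ≠ none) (hy : y ≠ none)
    (h : hubGraphPos x = hubGraphPos y) : x = y := by
  rcases x with _ | a <;> rcases y with _ | b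
  · rfl
  · exact absurd rfl hx
  · exact absurd rfl hy
  · simp only [hubGraphPos, Option.elim_some] at h
    congr
    omega

theorem hubGraphPos_step {D : ℕ → Prop} {L : ℕ} {x y : Option (Fin (L + 1))}
    (h : (hubGraph D L).Adj x y) (hx : x ≠ none) (hy : y ≠ none) :
    hubGraphPos y = hubGraphPos x + 1 ∨ hubGraphPos x = hubGraphPos y + 1 := by
  rcases x with _ | a <;> rcases y with _ | b
  · exact absurd rfl hx
  · exact absurd rfl hx
  · exact absurd rfl hy
  · simp only [hubGraphPos, Option.elim_some]
    simp only [hubGraph] at h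
    omega

/-- Without the hub, a cycle of this length has m + 1 consecutive path vertices, whose two ends are
in `D` at distance m. -/
theorem hubGraph_isCycle_length_ne {D : ℕ → Prop} {L m : ℕ} (hD : ∀ a, D a → ¬ D (a + m))
    {x : Option (Fin (L + 1))} {c : (hubGraph D L).Walk x x} (hc : c.IsCycle) :
    c.length ≠ m + 2 := by
  classical
  intro hlen
  have h3 := hc.three_le_length
  by_cases hmem : none ∈ c.support
  · obtain ⟨d, hd, hdl⟩ : ∃ d : (hubGraph D L).Walk none none, d.IsCycle ∧ d.length = m + 2 :=
      ⟨c.rotate none hmem, hc.rotate hmem, by rw [SimpleGraph.Walk.length_rotate, hlen]⟩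
    have hinj := hd.getVert_injOn
    rw [hdl] at hinj
    have hend : d.getVert (m + 2) = none := by rw [← hdl, SimpleGraph.Walk.getVert_length]
    have hne : ∀ i ≤ m, d.getVert (i + 1) ≠ none := fun i hi h => by
      have := hinj (x₁ := i + 1) (x₂ := m + 2) (by simp; omega) (by simp) (h.trans hend.symm)
      omega
    have hmono := eq_add_or_eq_sub_of_injective_steps (fun i => hubGraphPos (d.getVert (i + 1))) m
      (fun i hi => hubGraphPos_step (d.adj_getVert_succ (by omega)) (hne _ (by omega))
        (hne _ (by omega)))
      (fun i hi j hj hij => by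
        have := hinj (x₁ := i + 1) (x₂ := j + 1) (by simp; omega) (by simp; omega)
          (hubGraphPos_inj (hne i hi) (hne j hj) hij)
        omega)
    have hfirst : (hubGraph D L).Adj none (d.getVert (0 + 1)) := by
      simpa using d.adj_getVert_succ (i := 0) (by omega)
    have hlast : (hubGraph D L).Adj (d.getVert (m + 1)) none := by
      simpa [hend] using d.adj_getVert_succ (i := m + 1) (by omega)
    have hpos : ∀ y, (hubGraph D L).Adj none y → ∃ a : ℕ, D a ∧ hubGraphPos y = a := by
      rintro (_ | a) h
      · exact h.elim
      · exact ⟨a, h, rfl⟩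
    obtain ⟨a, ha, hpa⟩ := hpos _ hfirst
    obtain ⟨b, hb, hpb⟩ := hpos _ hlast.symm
    rcases hmono with h | h
    · have := h m le_rfl
      obtain rfl : b = a + m := by omega
      exact hD a ha hb
    · have := h m le_rfl
      obtain rfl : a = b + m := by omega
      exact hD b hb ha
  -- A cycle missing the hub would run monotonically along the path, so its last vertex could not be
  -- next to its first.
  · have hne : ∀ i, c.getVert i ≠ none := fun i h => hmem (h ▸ c.getVert_mem_support i)
    have hinj := hc.getVert_injOn'
    have hmono := eq_add_or_eq_sub_of_injective_steps (fun i => hubGraphPos (c.getVert i)) (m + 1)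
      (fun i hi => hubGraphPos_step (c.adj_getVert_succ (by omega)) (hne _) (hne _))
      (fun i hi j hj hij => hinj (by simp; omega) (by simp; omega)
        (hubGraphPos_inj (hne i) (hne j) hij))
    have hlast := hubGraphPos_step (c.adj_getVert_succ (i := m + 1) (by omega)) (hne _) (hne _)
    rw [← hlen, c.getVert_length] at hlast
    rcases hmono with h | h
    · have := h (m + 1) le_rfl
      simp only [SimpleGraph.Walk.getVert_zero] at this
      push_cast at this
      omega
    · have := h (m + 1) le_rfl
      simp only [SimpleGraph.Walk.getVert_zero] at this
      push_cast at this
      omega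

/-- The greedy set of natural numbers without two elements at distance `1` or `m`. -/
def sparse (m a : ℕ) : Prop :=
  (∀ _h : 1 ≤ a, ¬ sparse m (a - 1)) ∧ (∀ _h : 1 ≤ m ∧ m ≤ a, ¬ sparse m (a - m))
termination_by a
decreasing_by all_goals omega

theorem sparse_zero (m : ℕ) : sparse m 0 := by
  rw [sparse]; exact ⟨fun h => by omega, fun h => by omega⟩

theorem not_sparse_add {m a : ℕ} (hm : 1 ≤ m) (h : sparse m a) : ¬ sparse m (a + m) := by
  rw [sparse]
  rintro ⟨-, h'⟩
  exact h' ⟨hm, by omega⟩ (by simpa using h)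

/-- If all three are missing, then a + 1 and a + 2 were not rejected because of their predecessors,
so a + 1 - m and a + 2 - m are both in the set, although they are consecutive. -/
theorem exists_sparse_of_three {m : ℕ} (a : ℕ) :
    sparse m a ∨ sparse m (a + 1) ∨ sparse m (a + 2) := by
  by_contra! h
  obtain ⟨h0, h1, h2⟩ := h
  have h1' := h1
  have h2' := h2
  rw [sparse] at h1' h2'
  simp only [Nat.add_sub_cancel, le_add_iff_nonneg_left, zero_le, forall_const, h0,
    not_false_eq_true, true_and, show a + 2 - 1 = a + 1 from rfl, h1, not_forall, not_not, show 1 ≤ a + 2 by omega] at h1' h2'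
  obtain ⟨hm1, e1⟩ := h1'
  obtain ⟨hm2, e2⟩ := h2'
  rw [sparse] at e2
  exact e2.1 (by omega) (by rwa [show a + 2 - m - 1 = a + 1 - m by omega])

theorem exists_sparse_ge (m n : ℕ) : ∃ L ≥ n, sparse m L := by
  rcases exists_sparse_of_three (m := m) n with h | h | h
  exacts [⟨_, le_rfl, h⟩, ⟨_, by omega, h⟩, ⟨_, by omega, h⟩]

/-- An inner position has an element of the set among itself and its two neighbours. At the ends one
neighbour is missing, so there 0 and `L` themselves serve; hence the hypothesis on `L`. -/
theorem hubGraph_sparse_ediam_le {m L : ℕ} (hL : sparse m L) : (hubGraph (sparse m) L).ediam ≤ 4 := by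
  refine hubGraph_ediam_le fun a ha => ?_
  rcases Nat.eq_zero_or_pos a with rfl | h0
  · exact ⟨0, by omega, sparse_zero m, Or.inl rfl⟩
  rcases Nat.lt_or_ge a L with h | h
  · rcases exists_sparse_of_three (m := m) (a - 1) with h | h | h
    · exact ⟨a - 1, by omega, h, by omega⟩
    · exact ⟨a, by omega, by rwa [Nat.sub_add_cancel h0] at h, by omega⟩
    · exact ⟨a + 1, by omega, by rwa [show a - 1 + 2 = a + 1 by omega] at h, by omega⟩
  · exact ⟨L, le_rfl, hL, by omega⟩

end Obstructions

/-! ### Coordinates on the legs of the H-graph -/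

section Arms

/-- The vertex at signed position `z` on the path formed by the two legs at the end `s` of the
central path of `subdividedH 2 (l + 1)`. -/
def armPos (l : ℕ) (s : Bool) (z : ℤ) : Fin (2 + 1) ⊕ (Bool × Bool × Fin (l + 1)) :=
  if z = 0 then Sum.inl (if s then 2 else 0)
  else Sum.inr (s, decide (0 < z), Fin.ofNat (l + 1) (z.natAbs - 1))

theorem armPos_zero (l : ℕ) (s : Bool) : armPos l s 0 = Sum.inl (if s then 2 else 0) :=
  if_pos rfl

theorem armPos_of_ne (l : ℕ) (s : Bool) {z : ℤ} (hz : z ≠ 0) :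
    armPos l s z = Sum.inr (s, decide (0 < z), Fin.ofNat (l + 1) (z.natAbs - 1)) :=
  if_neg hz

theorem armPos_ne_middle (l : ℕ) (s : Bool) (z : ℤ) : armPos l s z ≠ Sum.inl 1 := by
  rcases eq_or_ne z 0 with rfl | h
  · rw [armPos_zero]
    cases s <;> simp
  · rw [armPos_of_ne _ _ h]
    exact Sum.inr_ne_inl

/-- The bounds keep `Fin.ofNat` from wrapping around. -/
theorem armPos_injective {l : ℕ} {s s' : Bool} {z z' : ℤ} (hz : z.natAbs ≤ l + 1)
    (hz' : z'.natAbs ≤ l + 1) (h : armPos l s z = armPos l s' z') : s = s' ∧ z = z' := by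
  rcases eq_or_ne z 0 with rfl | h1 <;> rcases eq_or_ne z' 0 with rfl | h2
  · rw [armPos_zero, armPos_zero] at h
    cases s <;> cases s' <;> simp at h ⊢
  · rw [armPos_zero, armPos_of_ne _ _ h2] at h
    exact absurd h Sum.inl_ne_inr
  · rw [armPos_zero, armPos_of_ne _ _ h1] at h
    exact absurd h Sum.inr_ne_inl
  · rw [armPos_of_ne _ _ h1, armPos_of_ne _ _ h2] at h
    replace h := Sum.inr_injective h
    rw [Prod.mk.injEq, Prod.mk.injEq] at h
    obtain ⟨rfl, hs, hf⟩ := h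
    refine ⟨rfl, ?_⟩
    have hf := congrArg Fin.val hf
    simp only [Fin.ofNat] at hf
    rw [Nat.mod_eq_of_lt (by omega), Nat.mod_eq_of_lt (by omega)] at hf
    rw [decide_eq_decide] at hs
    omega

theorem armPos_adj_middle (l : ℕ) (s : Bool) :
    (subdividedH 2 (l + 1)).Adj (Sum.inl 1) (armPos l s 0) := by
  cases s <;> simp [armPos, subdividedH]

theorem armPos_adj {l : ℕ} {s : Bool} {z : ℤ} (hz : z.natAbs ≤ l + 1)
    (hz' : (z + 1).natAbs ≤ l + 1) :
    (subdividedH 2 (l + 1)).Adj (armPos l s z) (armPos l s (z + 1)) := by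
  refine (SimpleGraph.fromRel_adj _ _ _).mpr ⟨fun h => ?_, ?_⟩
  · have := (armPos_injective hz hz' h).2
    omega
  · unfold armPos
    rcases lt_trichotomy z 0 with h | rfl | h
    · rcases eq_or_ne (z + 1) 0 with h' | h'
      · obtain rfl : z = -1 := by omega
        right
        cases s <;> simp [Fin.ofNat]
      · right
        rw [if_neg h', if_neg h.ne]
        refine ⟨rfl, by rw [decide_eq_decide]; omega, ?_⟩
        simp only [Fin.ofNat]
        rw [Nat.mod_eq_of_lt (by omega), Nat.mod_eq_of_lt (by omega)]
        omega
    · left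
      cases s <;> simp [Fin.ofNat]
    · left
      rw [if_neg h.ne', if_neg (by omega)]
      refine ⟨rfl, by rw [decide_eq_decide]; omega, ?_⟩
      simp only [Fin.ofNat]
      rw [Nat.mod_eq_of_lt (by omega), Nat.mod_eq_of_lt (by omega)]
      omega

end Arms

/-! ### Embedding an acyclic graph that is linear up to one vertex -/

section HubDecomposition

variable {W : Type*} {F : SimpleGraph W}

/-- Here `ψ` places `F` on the integer line, except for at most one hub sent to `none`. The vertices
of side `t` keep their relative places, shifted so that `e t`, where the hub attaches, falls on an
end of the central path; the hub becomes its middle vertex. -/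
theorem isContained_subdividedH_of_pos {ψ : W → Option ℤ} (hinj : Function.Injective ψ) {L : ℕ}
    (hL : ∀ w a, ψ w = some a → 0 ≤ a ∧ a ≤ L)
    (hstep : ∀ u v a b, F.Adj u v → ψ u = some a → ψ v = some b → b = a + 1 ∨ a = b + 1)
    (s : W → Bool) (e : Bool → ℤ) (he : ∀ t, 0 ≤ e t ∧ e t ≤ L)
    (hs : ∀ u v, F.Adj u v → ψ u ≠ none → ψ v ≠ none → s u = s v)
    (hhub : ∀ u v b, F.Adj u v → ψ u = none → ψ v = some b → b = e (s v)) :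
    F ⊑ subdividedH 2 (L + 1) := by
  let g : W → Fin (2 + 1) ⊕ (Bool × Bool × Fin (L + 1)) := fun w =>
    (ψ w).elim (Sum.inl 1) fun a => armPos L (s w) (a - e (s w))
  have g_none : ∀ w, ψ w = none → g w = Sum.inl 1 := fun w h => by simp [g, h]
  have g_some : ∀ w a, ψ w = some a → g w = armPos L (s w) (a - e (s w)) :=
    fun w a h => by simp [g, h]
  have bound : ∀ w a, ψ w = some a → (a - e (s w)).natAbs ≤ L + 1 := fun w a h => by
    have := hL w a h
    have := he (s w)
    omega
  refine ⟨⟨⟨g, ?_⟩, ?_⟩⟩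
  · intro u v huv
    rcases hu : ψ u with _ | a <;> rcases hv : ψ v with _ | b
    · exact absurd (hinj (hu.trans hv.symm)) huv.ne
    · rw [g_none u hu, g_some v b hv, hhub u v b huv hu hv, sub_self]
      exact armPos_adj_middle _ _
    · rw [g_none v hv, g_some u a hu, hhub v u a huv.symm hv hu, sub_self]
      exact (armPos_adj_middle _ _).symm
    · have huv' := hs u v huv (by simp [hu]) (by simp [hv])
      have ha := bound u a hu
      have hb := bound v b hv
      rw [g_some u a hu, g_some v b hv, huv']
      rw [huv'] at ha
      rcases hstep u v a b huv hu hv with rfl | rfl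
      · rw [show a + 1 - e (s v) = a - e (s v) + 1 by ring] at hb ⊢
        exact armPos_adj ha hb
      · rw [show b + 1 - e (s v) = b - e (s v) + 1 by ring] at ha ⊢
        exact (armPos_adj hb ha).symm
  · intro u v huv
    change g u = g v at huv
    rcases hu : ψ u with _ | a <;> rcases hv : ψ v with _ | b
    · exact hinj (hu.trans hv.symm)
    · rw [g_none u hu, g_some v b hv] at huv
      exact absurd huv.symm (armPos_ne_middle _ _ _)
    · rw [g_none v hv, g_some u a hu] at huv
      exact absurd huv (armPos_ne_middle _ _ _)
    · rw [g_some u a hu, g_some v b hv] at huv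
      obtain ⟨h1, h2⟩ := armPos_injective (bound u a hu) (bound v b hv) huv
      rw [h1] at h2
      obtain rfl : a = b := sub_left_injective h2
      exact hinj (hu.trans hv.symm)

/-- Here `e` picks a root in each component left by the hub. Since a component lies on one side of
its root, the distance to the root can serve as the position on a leg. -/
theorem isContained_subdividedStar_of_pos [Finite W] {ψ : W → Option ℤ}
    (hinj : Function.Injective ψ) {L : ℕ} (hL : ∀ w a, ψ w = some a → 0 ≤ a ∧ a ≤ L)
    (hstep : ∀ u v a b, F.Adj u v → ψ u = some a → ψ v = some b → b = a + 1 ∨ a = b + 1)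
    (e : W → W) (he : ∀ w, ψ w ≠ none → ψ (e w) ≠ none)
    (headj : ∀ u v, F.Adj u v → ψ u ≠ none → ψ v ≠ none → e u = e v)
    (hhub : ∀ u v, F.Adj u v → ψ u = none → e v = v)
    (hside : ∀ r, (∀ w a b, e w = r → ψ w = some a → ψ r = some b → b ≤ a) ∨
      (∀ w a b, e w = r → ψ w = some a → ψ r = some b → a ≤ b)) :
    ∃ (k : ℕ) (len : Fin k → ℕ), 3 ≤ k ∧ (∀ i, 1 ≤ len i) ∧ F ⊑ subdividedStar k len := by
  obtain ⟨n, ⟨ι⟩⟩ := Finite.exists_equiv_fin W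
  -- One leg for each possible root; the three extra legs ensure that there are at least three.
  refine ⟨n + 3, fun _ => L + 1, by omega, fun _ => Nat.succ_pos L, ?_⟩
  let idx : W → Fin (n + 3) := fun w => Fin.castAdd 3 (ι w)
  have idx_inj : Function.Injective idx := (Fin.castAdd_injective n 3).comp ι.injective
  let pos : W → ℤ := fun w => (ψ w).getD 0
  have pos_some : ∀ w a, ψ w = some a → pos w = a := fun w a h => by simp [pos, h]
  let off : W → ℕ := fun w => (pos w - pos (e w)).natAbs
  have off_lt : ∀ w, ψ w ≠ none → off w < L + 1 := by
    intro w hw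
    obtain ⟨a, ha⟩ := Option.ne_none_iff_exists'.mp hw
    obtain ⟨b, hb⟩ := Option.ne_none_iff_exists'.mp (he w hw)
    have h1 := hL _ _ ha
    have h2 := hL _ _ hb
    simp only [off, pos_some _ _ ha, pos_some _ _ hb]
    omega
  let g : W → Option (Σ _ : Fin (n + 3), Fin (L + 1)) := fun w =>
    if ψ w = none then none else some ⟨idx (e w), Fin.ofNat (L + 1) (off w)⟩
  have g_none : ∀ w, ψ w = none → g w = none := fun w h => by simp [g, h]
  have g_some : ∀ w (h : ψ w ≠ none), g w = some ⟨idx (e w), ⟨off w, off_lt w h⟩⟩ :=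
    fun w h => by
      simp only [g, if_neg h, Fin.ofNat, Nat.mod_eq_of_lt (off_lt w h)]
  have ginj : Function.Injective g := by
    intro u v huv
    by_cases hu : ψ u = none <;> by_cases hv : ψ v = none
    · exact hinj (hu.trans hv.symm)
    · rw [g_none u hu, g_some v hv] at huv; simp at huv
    · rw [g_none v hv, g_some u hu] at huv; simp at huv
    · rw [g_some u hu, g_some v hv, Option.some.injEq, Sigma.mk.injEq] at huv
      obtain ⟨h1, h2⟩ := huv
      have h1 := idx_inj h1
      have h2 : off u = off v := congrArg Fin.val (eq_of_heq h2)
      obtain ⟨a, ha⟩ := Option.ne_none_iff_exists'.mp hu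
      obtain ⟨b, hb⟩ := Option.ne_none_iff_exists'.mp hv
      obtain ⟨c, hc⟩ := Option.ne_none_iff_exists'.mp (he v hv)
      have hc' := hc
      rw [← h1] at hc'
      simp only [off, pos_some _ _ ha, pos_some _ _ hb, pos_some _ _ hc, pos_some _ _ hc'] at h2
      apply hinj
      rw [ha, hb]
      congr 1
      rcases hside (e v) with h | h
      · have := h u a c h1 ha hc
        have := h v b c rfl hb hc
        omega
      · have := h u a c h1 ha hc
        have := h v b c rfl hb hc
        omega
  have some_adj : ∀ u v, F.Adj u v → ψ u ≠ none → ψ v ≠ none → off v = off u + 1 →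
      (subdividedStar (n + 3) fun _ => L + 1).Adj (g u) (g v) := by
    intro u v huv hu hv h
    refine (SimpleGraph.fromRel_adj _ _ _).mpr ⟨fun h' => huv.ne (ginj h'), Or.inl ?_⟩
    rw [g_some u hu, g_some v hv]
    exact ⟨by rw [headj u v huv hu hv], h⟩
  have none_adj : ∀ u v, F.Adj u v → ψ u = none → ψ v ≠ none →
      (subdividedStar (n + 3) fun _ => L + 1).Adj (g u) (g v) := by
    intro u v huv hu hv
    refine (SimpleGraph.fromRel_adj _ _ _).mpr ⟨fun h' => huv.ne (ginj h'), Or.inl ?_⟩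
    rw [g_none u hu, g_some v hv]
    change off v = 0
    simp [off, hhub u v huv hu]
  refine ⟨⟨⟨g, ?_⟩, ginj⟩⟩
  intro u v huv
  by_cases hu : ψ u = none <;> by_cases hv : ψ v = none
  · exact absurd (hinj (hu.trans hv.symm)) huv.ne
  · exact none_adj u v huv hu hv
  · exact (none_adj v u huv.symm hv hu).symm
  · have h1 := headj u v huv hu hv
    obtain ⟨a, ha⟩ := Option.ne_none_iff_exists'.mp hu
    obtain ⟨b, hb⟩ := Option.ne_none_iff_exists'.mp hv
    obtain ⟨c, hc⟩ := Option.ne_none_iff_exists'.mp (he v hv)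
    have hc' := hc
    rw [← h1] at hc'
    have : off v = off u + 1 ∨ off u = off v + 1 := by
      simp only [off, pos_some _ _ ha, pos_some _ _ hb, pos_some _ _ hc, pos_some _ _ hc']
      have hab := hstep u v a b huv ha hb
      rcases hside (e v) with h | h
      · have := h u a c h1 ha hc
        have := h v b c rfl hb hc
        omega
      · have := h u a c h1 ha hc
        have := h v b c rfl hb hc
        omega
    rcases this with h | h
    · exact some_adj u v huv hu hv h
    · exact (some_adj v u huv.symm hv hu h).symm

/-- `F` without the edges at the vertices sent to `none`. -/
def hubDeleted (F : SimpleGraph W) (ψ : W → Option ℤ) : SimpleGraph W where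
  Adj u v := F.Adj u v ∧ ψ u ≠ none ∧ ψ v ≠ none
  symm := ⟨fun _ _ h => ⟨h.1.symm, h.2.2, h.2.1⟩⟩
  loopless := ⟨fun _ h => F.loopless.irrefl _ h.1⟩

theorem hubDeleted_le (F : SimpleGraph W) (ψ : W → Option ℤ) : hubDeleted F ψ ≤ F :=
  fun _ _ h => h.1

theorem hubDeleted_support_ne_none {ψ : W → Option ℤ} {x y : W} (p : (hubDeleted F ψ).Walk x y)
    (hx : ψ x ≠ none) : ∀ z ∈ p.support, ψ z ≠ none := by
  induction p with
  | nil => simpa using hx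
  | cons h p ih =>
    intro z hz
    rw [SimpleGraph.Walk.support_cons, List.mem_cons] at hz
    rcases hz with rfl | hz
    · exact hx
    · exact ih h.2.2 z hz

/-- Otherwise the detour from `h` through `x` to `y` and the edge from `h` to `y` would be two
different paths. -/
theorem eq_of_adj_hub_of_reachable (hF : F.IsAcyclic) {ψ : W → Option ℤ} {h x y : W}
    (hh : ψ h = none) (hx : ψ x ≠ none) (hhx : F.Adj h x) (hhy : F.Adj h y)
    (hxy : (hubDeleted F ψ).Reachable x y) : x = y := by
  classical
  obtain ⟨p, hp⟩ := hxy.exists_isPath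
  have hsup := hubDeleted_support_ne_none p hx
  let q : F.Walk x y := p.mapLe (hubDeleted_le F ψ)
  have hq : q.IsPath := hp.mapLe _
  have hqs : h ∉ q.support := by
    rw [SimpleGraph.Walk.support_mapLe_eq_support]
    exact fun h' => hsup h h' hh
  have h1 : (SimpleGraph.Walk.cons hhx q).IsPath := hq.cons hqs
  have h2 : hhy.toWalk.IsPath := SimpleGraph.Walk.IsPath.of_adj hhy
  have := congrArg (fun r : F.Path h y => r.1.length) ((hF.subsingleton_path h y).elim ⟨_, h1⟩ ⟨_, h2⟩)
  simp only [SimpleGraph.Walk.length_cons, SimpleGraph.Adj.toWalk, SimpleGraph.Walk.length_nil] at this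
  exact SimpleGraph.Walk.eq_of_length_eq_zero (p := q) (by omega)

theorem isContained_subdividedH_of_hub (hF : F.IsAcyclic) {ψ : W → Option ℤ}
    (hinj : Function.Injective ψ) {L : ℕ} (hL : ∀ w a, ψ w = some a → 0 ≤ a ∧ a ≤ L)
    (hstep : ∀ u v a b, F.Adj u v → ψ u = some a → ψ v = some b → b = a + 1 ∨ a = b + 1)
    (hdeg : ∀ h a b c, ψ h = none → F.Adj h a → F.Adj h b → F.Adj h c → a = b ∨ a = c ∨ b = c) :
    F ⊑ subdividedH 2 (L + 1) := by
  classical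
  have hne : ∀ u v, F.Adj u v → ψ u = none → ψ v ≠ none := fun u v huv hu hv =>
    huv.ne (hinj (hu.trans hv.symm))
  by_cases hn : ∃ h x, ψ h = none ∧ F.Adj h x
  · obtain ⟨h, x, hh, hx⟩ := hn
    obtain ⟨y, hy, hall⟩ : ∃ y, F.Adj h y ∧ ∀ z, F.Adj h z → z = x ∨ z = y := by
      by_cases hy : ∃ y, F.Adj h y ∧ y ≠ x
      · obtain ⟨y, hy, hyx⟩ := hy
        refine ⟨y, hy, fun z hz => ?_⟩
        rcases hdeg h x y z hh hx hy hz with h | h | h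
        · exact absurd h.symm hyx
        · exact Or.inl h.symm
        · exact Or.inr h.symm
      · push Not at hy
        exact ⟨x, hx, fun z hz => Or.inl (hy z hz)⟩
    obtain ⟨a, ha⟩ := Option.ne_none_iff_exists'.mp (hne h x hx hh)
    obtain ⟨b, hb⟩ := Option.ne_none_iff_exists'.mp (hne h y hy hh)
    -- The component of `y` forms one side and everything else, including `x` if it differs from
    -- `y`, the other.
    refine isContained_subdividedH_of_pos hinj hL hstep
      (fun w => decide ((hubDeleted F ψ).Reachable y w)) (fun t => if t then b else a) ?_ ?_ ?_
    · rintro (_ | _)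
      · exact hL x a ha
      · exact hL y b hb
    · intro u v huv hu hv
      have : (hubDeleted F ψ).Adj u v := ⟨huv, hu, hv⟩
      rw [decide_eq_decide]
      exact ⟨fun h => h.trans this.reachable, fun h => h.trans this.symm.reachable⟩
    · intro u v c huv hu hv
      obtain rfl : u = h := hinj (hu.trans hh.symm)
      by_cases hr : (hubDeleted F ψ).Reachable y v
      · obtain rfl := eq_of_adj_hub_of_reachable hF hu (by simp [hb]) hy huv hr
        simpa [hb] using hv.symm
      · have hvx : v = x := (hall v huv).resolve_right fun h => hr (h ▸ SimpleGraph.Reachable.refl _)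
        subst hvx
        simpa [ha, hr] using hv.symm
  · push Not at hn
    exact isContained_subdividedH_of_pos hinj hL hstep (fun _ => true) (fun _ => 0)
      (fun _ => by simp) (fun _ _ _ _ _ => rfl) (fun u v b huv hu => absurd huv (hn u v hu))

theorem isContained_subdividedStar_of_hub [Finite W] (hF : F.IsAcyclic) {ψ : W → Option ℤ}
    (hinj : Function.Injective ψ) {L : ℕ} (hL : ∀ w a, ψ w = some a → 0 ≤ a ∧ a ≤ L)
    (hstep : ∀ u v a b, F.Adj u v → ψ u = some a → ψ v = some b → b = a + 1 ∨ a = b + 1)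
    (hdeg : ∀ h x a b c, ψ h = none → F.Adj h x → F.Adj x a → F.Adj x b → F.Adj x c →
      a = b ∨ a = c ∨ b = c) :
    ∃ (k : ℕ) (len : Fin k → ℕ), 3 ≤ k ∧ (∀ i, 1 ≤ len i) ∧ F ⊑ subdividedStar k len := by
  classical
  have hne : ∀ u v, F.Adj u v → ψ u = none → ψ v ≠ none := fun u v huv hu hv =>
    huv.ne (hinj (hu.trans hv.symm))
  have hwalk : ∀ {r w} (p : (hubDeleted F ψ).Walk r w) (P : ℤ → Prop),
      (∀ a, ψ r = some a → P a) →
      (∀ u v a b, (hubDeleted F ψ).Adj u v → ψ u = some a → ψ v = some b → P a → P b) →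
      ∀ a, ψ w = some a → P a := by
    intro r w p P h0 hs
    induction p with
    | nil => exact h0
    | @cons u v w h p ih =>
      refine ih fun b hb => ?_
      obtain ⟨a, ha⟩ := Option.ne_none_iff_exists'.mp h.2.1
      exact hs u v a b h ha hb (h0 a ha)
  have hroot : ∀ C : (hubDeleted F ψ).ConnectedComponent, ∃ r ∈ C.supp,
      (∀ h x, ψ h = none → F.Adj h x → x ∈ C.supp → x = r) ∧
      ((∀ w ∈ C.supp, ∀ a b, ψ w = some a → ψ r = some b → b ≤ a) ∨
        (∀ w ∈ C.supp, ∀ a b, ψ w = some a → ψ r = some b → a ≤ b)) := by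
    intro C
    by_cases hC : ∃ h x, ψ h = none ∧ F.Adj h x ∧ x ∈ C.supp
    · obtain ⟨h, x, hh, hx, hxC⟩ := hC
      obtain ⟨b, hb⟩ := Option.ne_none_iff_exists'.mp (hne h x hx hh)
      refine ⟨x, hxC, ?_, ?_⟩
      · intro h' x' hh' hx' hxC'
        obtain rfl : h' = h := hinj (hh'.trans hh.symm)
        refine (eq_of_adj_hub_of_reachable hF hh (hne _ _ hx hh) hx hx' ?_).symm
        exact SimpleGraph.ConnectedComponent.exact (hxC.trans hxC'.symm)
      · have reach : ∀ w ∈ C.supp, (hubDeleted F ψ).Reachable x w := fun w hw =>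
          SimpleGraph.ConnectedComponent.exact (hxC.trans hw.symm)
        -- Besides the hub, `x` has at most one neighbour. If that lies to the left, no walk in the
        -- component gets past `x` to the right.
        by_cases hl : ∃ y, F.Adj x y ∧ ψ y = some (b - 1)
        · right
          obtain ⟨y, hxy, hy⟩ := hl
          intro w hw a b' ha hb'
          obtain rfl : b = b' := Option.some_injective _ (hb.symm.trans hb')
          obtain ⟨p⟩ := reach w hw
          refine hwalk p (· ≤ b) (fun a ha => ?_) ?_ a ha
          · exact (Option.some_injective _ (ha.symm.trans hb)).le
          · intro u v c d huv hu hv hc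
            by_contra! hcon
            have h1 := hstep u v c d huv.1 hu hv
            obtain rfl : c = b := by omega
            obtain rfl : u = x := hinj (hu.trans hb.symm)
            rcases hdeg h u h y v hh hx hx.symm hxy huv.1 with h2 | h2 | h2
            · rw [← h2, hh] at hy; cases hy
            · rw [← h2, hh] at hv; cases hv
            · rw [h2, hv, Option.some.injEq] at hy; omega
        · left
          push Not at hl
          intro w hw a b' ha hb'
          obtain rfl : b = b' := Option.some_injective _ (hb.symm.trans hb')
          obtain ⟨p⟩ := reach w hw
          refine hwalk p (b ≤ ·) (fun a ha => ?_) ?_ a ha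
          · exact (Option.some_injective _ (ha.symm.trans hb)).ge
          · intro u v c d huv hu hv hc
            by_contra! hcon
            have h1 := hstep u v c d huv.1 hu hv
            obtain rfl : c = b := by omega
            obtain rfl : u = x := hinj (hu.trans hb.symm)
            exact hl v huv.1 (by rw [hv]; congr 1; omega)
    · push Not at hC
      have hfin : C.supp.Finite := Set.toFinite _
      -- A component without neighbours of the hub takes its leftmost vertex as root.
      obtain ⟨r, hr, hmin⟩ := Set.exists_min_image C.supp (fun w => (ψ w).getD 0) hfin C.nonempty_supp
      refine ⟨r, hr, fun h x hh hx hxC => absurd hxC (hC h x hh hx), Or.inl ?_⟩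
      intro w hw a b ha hb
      simpa [ha, hb] using hmin w hw
  choose root hroot_mem hroot_hub hroot_side using hroot
  let e : W → W := fun w => root ((hubDeleted F ψ).connectedComponentMk w)
  have he_reach : ∀ w, (hubDeleted F ψ).Reachable w (e w) := fun w =>
    SimpleGraph.ConnectedComponent.exact (hroot_mem _).symm
  refine isContained_subdividedStar_of_pos hinj hL hstep e ?_ ?_ ?_ ?_
  · intro w hw
    obtain ⟨p⟩ := he_reach w
    exact hubDeleted_support_ne_none p hw _ p.end_mem_support
  · intro u v huv hu hv
    have : (hubDeleted F ψ).Adj u v := ⟨huv, hu, hv⟩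
    simp only [e]
    rw [SimpleGraph.ConnectedComponent.sound this.reachable]
  · intro u v huv hu
    exact (hroot_hub _ u v hu huv rfl).symm
  · intro r
    have hmem : ∀ w, e w = r → w ∈ ((hubDeleted F ψ).connectedComponentMk r).supp ∧
        root ((hubDeleted F ψ).connectedComponentMk r) = r := by
      rintro w rfl
      have h := SimpleGraph.ConnectedComponent.sound (he_reach w)
      refine ⟨h, ?_⟩
      rw [← h]
    rcases hroot_side ((hubDeleted F ψ).connectedComponentMk r) with h | h
    · left
      intro w a b hw ha hb
      obtain ⟨h1, h2⟩ := hmem w hw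
      exact h w h1 a b ha (by rw [h2, hb])
    · right
      intro w a b hw ha hb
      obtain ⟨h1, h2⟩ := hmem w hw
      exact h w h1 a b ha (by rw [h2, hb])

end HubDecomposition

/-! ### Necessity -/

theorem isContained_of_forall_treedepth_le {W : Type*} [Finite W] {F : SimpleGraph W} {c : ℕ}
    (h : ∀ (V : Type) [Fintype V] (G : SimpleGraph V), F.Free G → G.ediam ≤ 4 → treedepth G ≤ c) :
    (∃ (k : ℕ) (len : Fin k → ℕ), 3 ≤ k ∧ (∀ i, 1 ≤ len i) ∧ F ⊑ subdividedStar k len) ∨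
      ∃ l : ℕ, 1 ≤ l ∧ F ⊑ subdividedH 2 l := by
  classical
  have hcon : ∀ (V : Type) [Fintype V] (G : SimpleGraph V) (n : ℕ) (p : ℕ → V), G.ediam ≤ 4 →
      IsPathSeq G n p → 2 ^ c ≤ n → F ⊑ G := by
    intro V _ G n p hG hp hn
    by_contra hF
    have := h V G hF hG
    have := lt_treedepth_of_isPathSeq hp hn
    omega
  have hhub : ∀ m, ∃ L, F ⊑ hubGraph (sparse m) L := by
    intro m
    obtain ⟨L, hL, hsp⟩ := exists_sparse_ge m (2 ^ c)
    obtain ⟨p, hp⟩ := hubGraph_exists_isPathSeq (sparse m) L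
    exact ⟨L, hcon _ _ _ p (hubGraph_sparse_ediam_le hsp) hp (by omega)⟩
  have hacyc : F.IsAcyclic := by
    intro v w hw
    have h3 := hw.three_le_length
    -- This parameter excludes exactly the cycles of the length of `w`.
    obtain ⟨L, ⟨f⟩⟩ := hhub (w.length - 2)
    have hc : (w.map f.toHom).IsCycle := hw.map f.injective
    refine hubGraph_isCycle_length_ne (m := w.length - 2)
      (fun a ha => not_sparse_add (by omega) ha) hc ?_
    rw [SimpleGraph.Walk.length_map]
    omega
  obtain ⟨p, hp⟩ := subdividedComplete_exists_isPathSeq (2 ^ c)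
  obtain ⟨f⟩ := hcon _ _ _ p (subdividedComplete_ediam_le _) hp (by omega)
  have hbranch : ∀ x y, F.Adj x y →
      (∀ a b c, F.Adj x a → F.Adj x b → F.Adj x c → a = b ∨ a = c ∨ b = c) ∨
      (∀ a b c, F.Adj y a → F.Adj y b → F.Adj y c → a = b ∨ a = c ∨ b = c) := by
    intro x y hxy
    have finj : Function.Injective ⇑f := f.injective
    have hf : ∀ {u v}, F.Adj u v → (subdividedComplete (2 ^ c + 1)).Adj (f u) (f v) :=
      fun h => f.toHom.map_adj h
    refine (subdividedComplete_not_branching (hf hxy)).imp ?_ ?_ <;>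
    · intro h a b c ha hb hc
      have := h _ _ _ (hf ha) (hf hb) (hf hc)
      rwa [finj.eq_iff, finj.eq_iff, finj.eq_iff] at this
  -- From here on only the shape matters, a path and a hub; any parameter would do.
  obtain ⟨L, ⟨g⟩⟩ := hhub 1
  let ψ : W → Option ℤ := fun w => Option.map (fun a : Fin (L + 1) => ((a : ℕ) : ℤ)) (g w)
  have hinj : Function.Injective ψ := by
    refine (Option.map_injective fun a b hab => ?_).comp g.injective
    simpa [Fin.ext_iff] using hab
  have hψ : ∀ w a, ψ w = some a → ∃ b, g w = some b ∧ ((b : ℕ) : ℤ) = a := fun w a h => by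
    simpa [ψ, Option.map_eq_some_iff] using h
  have hL : ∀ w a, ψ w = some a → 0 ≤ a ∧ a ≤ L := by
    intro w a hw
    obtain ⟨b, -, rfl⟩ := hψ w a hw
    omega
  have hstep : ∀ u v a b, F.Adj u v → ψ u = some a → ψ v = some b → b = a + 1 ∨ a = b + 1 := by
    intro u v a b huv hu hv
    obtain ⟨a, ha, rfl⟩ := hψ u a hu
    obtain ⟨b, hb, rfl⟩ := hψ v b hv
    have : (hubGraph (sparse 1) L).Adj (g u) (g v) := g.toHom.map_adj huv
    rw [ha, hb] at this
    simp only [hubGraph] at this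
    omega
  by_cases hdeg : ∀ h a b c, ψ h = none → F.Adj h a → F.Adj h b → F.Adj h c →
      a = b ∨ a = c ∨ b = c
  · exact Or.inr ⟨L + 1, by omega, isContained_subdividedH_of_hub hacyc hinj hL hstep hdeg⟩
  · left
    refine isContained_subdividedStar_of_hub hacyc hinj hL hstep ?_
    intro h x a b c hh hx
    push Not at hdeg
    obtain ⟨h', a', b', c', hh', ha', hb', hc', h1, h2, h3⟩ := hdeg
    obtain rfl : h' = h := hinj (hh'.trans hh.symm)
    -- The hub has three neighbours, so its neighbour `x` is not branching.
    rcases hbranch h' x hx with h | h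
    · have := h a' b' c' ha' hb' hc'
      tauto
    · exact h a b c

/-! ### Legs and rich vertices -/

section Legs

variable {V : Type*} {G : SimpleGraph V}

/-- `v :: l` is the list of vertices of a path of `G` with `n` edges. -/
structure IsLeg (G : SimpleGraph V) (n : ℕ) (v : V) (l : List V) : Prop where
  chain : (v :: l).IsChain G.Adj
  nodup : (v :: l).Nodup
  length_eq : l.length = n

/-- From `v` a path with `n` edges starts that avoids any prescribed set of at most `s` other
vertices. -/
def IsRich (G : SimpleGraph V) (s n : ℕ) (v : V) : Prop :=
  ∀ S : Finset V, S.card ≤ s → v ∉ S → ∃ l, IsLeg G n v l ∧ ∀ x ∈ l, x ∉ S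

theorem isLeg_take {n : ℕ} {v : V} {l : List V} (hc : (v :: l).IsChain G.Adj)
    (hn : (v :: l).Nodup) (hl : n ≤ l.length) : IsLeg G n v (l.take n) where
  chain := hc.take (n + 1)
  nodup := hn.sublist ((List.take_sublist n l).cons_cons v)
  length_eq := by simpa using hl

theorem IsPathSeq.isLeg {n : ℕ} {p : ℕ → V} (hp : IsPathSeq G (n + 1) p) :
    IsLeg G n (p 0) ((List.range n).map fun i => p (i + 1)) := by
  have h : p 0 :: (List.range n).map (fun i => p (i + 1)) = (List.range (n + 1)).map p := by
    rw [List.range_succ_eq_map, List.map_cons, List.map_map]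
    rfl
  refine ⟨?_, ?_, by simp⟩
  · rw [h, List.isChain_iff_getElem]
    intro i hi
    simp only [List.length_map, List.length_range] at hi
    simpa using hp.adj i hi
  · rw [h]
    refine List.Nodup.map_on ?_ List.nodup_range
    intro i hi j hj
    exact hp.inj i (List.mem_range.mp hi) j (List.mem_range.mp hj)

theorem IsLeg.getElem_adj {n : ℕ} {v : V} {l : List V} (h : IsLeg G n v l) {j : ℕ}
    (hj : j + 1 < l.length) : G.Adj l[j] l[j + 1] :=
  List.isChain_iff_getElem.mp h.chain.tail j hj

theorem IsLeg.adj_getElem_zero {n : ℕ} {v : V} {l : List V} (h : IsLeg G n v l)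
    (hj : 0 < l.length) : G.Adj v l[0] := by
  simpa using List.isChain_iff_getElem.mp h.chain 0 (by simpa using hj)

theorem IsLeg.getElem_inj {n : ℕ} {v : V} {l : List V} (h : IsLeg G n v l) {i j : ℕ}
    (hi : i < l.length) (hj : j < l.length) (hij : l[i] = l[j]) : i = j :=
  (h.nodup.of_cons.getElem_inj_iff).mp hij

theorem IsLeg.notMem {n : ℕ} {v : V} {l : List V} (h : IsLeg G n v l) : v ∉ l :=
  (List.nodup_cons.mp h.nodup).1

theorem adj_of_fromRel_adj {U : Type*} {r : U → U → Prop} {g : U → V}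
    (h : ∀ x y, r x y → G.Adj (g x) (g y)) {x y : U} (hxy : (SimpleGraph.fromRel r).Adj x y) :
    G.Adj (g x) (g y) := by
  rcases ((SimpleGraph.fromRel_adj _ _ _).mp hxy).2 with h' | h'
  · exact h x y h'
  · exact (h y x h').symm

/-- Two ends joined by a path with two edges, and two legs at each of them, form a copy of
`subdividedH 2 n`. -/
theorem subdividedH_isContained {n : ℕ} (e : Bool → V) (m : V) (leg : Bool → Bool → List V)
    (he : e false ≠ e true) (hm : ∀ s, G.Adj (e s) m) (hleg : ∀ s t, IsLeg G n (e s) (leg s t))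
    (hml : ∀ s t, m ∉ leg s t) (hel : ∀ s t, e (!s) ∉ leg s t)
    (hdisj : ∀ s t s' t', (s, t) ≠ (s', t') → (leg s t).Disjoint (leg s' t')) :
    subdividedH 2 n ⊑ G := by
  have hel' : ∀ s s' t, e s ∉ leg s' t := by
    intro s s' t
    rcases Bool.eq_or_eq_not s s' with rfl | rfl
    · exact (hleg s t).notMem
    · exact hel s' t
  let g : Fin (2 + 1) ⊕ (Bool × Bool × Fin n) → V := Sum.elim ![e false, m, e true]
    fun p => (leg p.1 p.2.1)[p.2.2]'(by rw [(hleg _ _).length_eq]; exact p.2.2.2)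
  have ginr : ∀ p, g (Sum.inr p) ∈ leg p.1 p.2.1 := fun p => List.getElem_mem _
  have hinl : ∀ a : Fin (2 + 1), ∀ s t, g (Sum.inl a) ∉ leg s t := by
    intro a s t
    fin_cases a
    · exact hel' false s t
    · exact hml s t
    · exact hel' true s t
  have ginj : Function.Injective g := by
    rintro (a | ⟨s, t, j⟩) (b | ⟨s', t', j'⟩) h
    · congr 1
      have h1 := (hm false).ne
      have h2 := (hm true).ne
      fin_cases a <;> fin_cases b <;>
        simp [g, h1, h2, h1.symm, h2.symm, he, he.symm] at h ⊢
    · exact absurd (h ▸ ginr (s', t', j')) (hinl a s' t')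
    · exact absurd (h ▸ ginr (s, t, j)) (hinl b s t)
    · by_cases hst : (s, t) = (s', t')
      · obtain ⟨rfl, rfl⟩ := Prod.mk.injEq .. ▸ hst
        obtain rfl : j = j' := Fin.ext ((hleg s t).getElem_inj _ _ h)
        rfl
      · exact absurd (h ▸ ginr (s', t', j')) (hdisj s t s' t' hst (ginr (s, t, j)))
  refine ⟨⟨⟨g, fun {x y} hxy => adj_of_fromRel_adj ?_ hxy⟩, ginj⟩⟩
  rintro (a | ⟨s, t, j⟩) (b | ⟨s', t', j'⟩) h
  · fin_cases a <;> fin_cases b <;> simp at h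
    · exact hm false
    · exact (hm true).symm
  · obtain ⟨h1, h2⟩ := h
    have hz : (leg s' t')[0]'(by rw [(hleg _ _).length_eq]; omega) = g (Sum.inr (s', t', j')) := by
      simp [g, h2]
    rw [← hz]
    cases s'
    · obtain rfl : a = 0 := Fin.ext h1
      exact (hleg _ _).adj_getElem_zero _
    · obtain rfl : a = 2 := Fin.ext h1
      exact (hleg _ _).adj_getElem_zero _
  · exact h.elim
  · obtain ⟨rfl, rfl, h⟩ := h
    have := (hleg s t).getElem_adj (j := j) (by rw [(hleg _ _).length_eq]; omega)
    simpa [g, h] using this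

theorem subdividedStar_isContained {k : ℕ} {len : Fin k → ℕ} {n : ℕ} (hlen : ∀ i, len i ≤ n)
    (v : V) (leg : Fin k → List V) (hleg : ∀ i, IsLeg G n v (leg i))
    (hdisj : ∀ i j, i ≠ j → (leg i).Disjoint (leg j)) : subdividedStar k len ⊑ G := by
  let g : Option (Σ i : Fin k, Fin (len i)) → V := fun x => x.elim v
    fun p => (leg p.1)[p.2]'(by rw [(hleg _).length_eq]; exact p.2.2.trans_le (hlen _))
  have gsome : ∀ p, g (some p) ∈ leg p.1 := fun p => List.getElem_mem _
  have ginj : Function.Injective g := by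
    rintro (_ | ⟨i, j⟩) (_ | ⟨i', j'⟩) h
    · rfl
    · have := gsome ⟨i', j'⟩
      rw [← h] at this
      exact absurd this (hleg i').notMem
    · have := gsome ⟨i, j⟩
      rw [h] at this
      exact absurd this (hleg i).notMem
    · by_cases hi : i = i'
      · subst hi
        have := (hleg i).getElem_inj _ _ h
        congr
        exact Fin.ext this
      · exact absurd (h ▸ gsome ⟨i', j'⟩) (hdisj i i' hi (gsome ⟨i, j⟩))
  refine ⟨⟨⟨g, fun {x y} hxy => adj_of_fromRel_adj ?_ hxy⟩, ginj⟩⟩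
  rintro (_ | ⟨i, j⟩) (_ | ⟨i', j'⟩) h
  · exact h.elim
  · have := (hleg i').adj_getElem_zero
      (by rw [(hleg i').length_eq]; have := hlen i'; have := j'.2; omega)
    change (j' : ℕ) = 0 at h
    simpa [g, h] using this
  · exact h.elim
  · obtain ⟨rfl, h⟩ : i = i' ∧ (j' : ℕ) = j + 1 := h
    have := (hleg i).getElem_adj (j := j) (by
      rw [(hleg i).length_eq]; have := hlen i; have := j'.2; omega)
    simpa [g, h] using this

/-- The legs are chosen greedily: the earlier ones together have few enough vertices to be forbidden
for the next one. -/
theorem IsRich.exists_disjoint_legs {s n : ℕ} {v : V} (hv : IsRich G s n v) (k : ℕ)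
    (hk : k * n ≤ s) : ∃ leg : ℕ → List V, (∀ i < k, IsLeg G n v (leg i)) ∧
      ∀ i < k, ∀ j < k, i ≠ j → (leg i).Disjoint (leg j) := by
  classical
  induction k with
  | zero => exact ⟨fun _ => [], by simp, by simp⟩
  | succ k ih =>
    obtain ⟨leg, h1, h2⟩ := ih (by rw [Nat.succ_mul] at hk; omega)
    let S := (Finset.range k).biUnion fun i => (leg i).toFinset
    have hS : S.card ≤ s := by
      refine (Finset.card_biUnion_le_card_mul _ _ n fun i hi => ?_).trans ?_
      · rw [← (h1 i (Finset.mem_range.mp hi)).length_eq]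
        exact List.toFinset_card_le _
      · rw [Finset.card_range]
        exact (Nat.mul_le_mul_right n k.le_succ).trans hk
    have hvS : v ∉ S := by
      simp only [S, Finset.mem_biUnion, Finset.mem_range, List.mem_toFinset, not_exists, not_and]
      exact fun i hi => (h1 i hi).notMem
    obtain ⟨l, hl, hlS⟩ := hv S hS hvS
    have hd : ∀ i < k, (leg i).Disjoint l := fun i hi x hx hxl =>
      hlS x hxl (Finset.mem_biUnion.mpr ⟨i, Finset.mem_range.mpr hi, List.mem_toFinset.mpr hx⟩)
    refine ⟨fun i => if i < k then leg i else l, ?_, ?_⟩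
    · intro i hi
      beta_reduce
      split_ifs with h
      · exact h1 i h
      · exact hl
    · intro i hi j hj hij
      beta_reduce
      split_ifs with h h' h'
      · exact h2 i h j h' hij
      · exact hd i h
      · exact (hd j h').symm
      · omega

theorem IsRich.subdividedStar_isContained {s n k : ℕ} {v : V} {len : Fin k → ℕ}
    (hv : IsRich G s n v) (hlen : ∀ i, len i ≤ n) (hk : k * n ≤ s) : subdividedStar k len ⊑ G := by
  obtain ⟨leg, h1, h2⟩ := hv.exists_disjoint_legs k hk
  exact _root_.subdividedStar_isContained hlen v (fun i => leg i) (fun i => h1 i i.2)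
    fun i j hij => h2 i i.2 j j.2 (Fin.val_injective.ne hij)

end Legs

/-! ### Segments of a long path and the descent towards rich vertices -/

section Segments

variable {V : Type*} {G : SimpleGraph V}

/-- `σ i 0, …, σ i (4 * n)` for `i < M` are disjoint paths of `G`. -/
structure IsSegmentFamily (G : SimpleGraph V) (M n : ℕ) (σ : ℕ → ℕ → V) : Prop where
  adj : ∀ i < M, ∀ h < 4 * n, G.Adj (σ i h) (σ i (h + 1))
  inj : ∀ i < M, ∀ j < M, ∀ h ≤ 4 * n, ∀ h' ≤ 4 * n, σ i h = σ j h' → i = j ∧ h = h'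

/-- The segments are consecutive blocks of the path. With 4n edges, every vertex of a segment starts
a path of n edges inside it, and every vertex between positions n and 3n starts one in each
direction. -/
theorem IsPathSeq.isSegmentFamily {M n : ℕ} {p : ℕ → V} (hp : IsPathSeq G (M * (4 * n + 1)) p) :
    IsSegmentFamily G M n fun i h => p (i * (4 * n + 1) + h) := by
  have key : ∀ i < M, ∀ h ≤ 4 * n, i * (4 * n + 1) + h < M * (4 * n + 1) := by
    intro i hi h hh
    have := Nat.mul_le_mul_right (4 * n + 1) (Nat.succ_le_of_lt hi)
    rw [Nat.succ_mul] at this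
    omega
  refine ⟨fun i hi h hh => hp.adj _ (key i hi (h + 1) (by omega)), ?_⟩
  intro i hi j hj h hh h' hh' heq
  have := hp.inj _ (key i hi h hh) _ (key j hj h' hh') heq
  have hq := congrArg (· / (4 * n + 1)) this
  simp only [Nat.mul_comm _ (4 * n + 1)] at hq
  rw [Nat.mul_add_div (by omega), Nat.mul_add_div (by omega), Nat.div_eq_of_lt (by omega),
    Nat.div_eq_of_lt (by omega)] at hq
  obtain rfl : i = j := by simpa using hq
  exact ⟨rfl, by omega⟩

theorem IsSegmentFamily.exists_isLeg_up {M n : ℕ} {σ : ℕ → ℕ → V} (hσ : IsSegmentFamily G M n σ)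
    {i h k : ℕ} (hi : i < M) (hh : h + k ≤ 4 * n) :
    ∃ l, IsLeg G k (σ i h) l ∧ ∀ x ∈ l, ∃ h', h < h' ∧ h' ≤ h + k ∧ x = σ i h' := by
  have hp : IsPathSeq G (k + 1) fun t => σ i (h + t) :=
    ⟨fun t ht => hσ.adj i hi (h + t) (by omega), fun a ha b hb hab => by
      have := (hσ.inj i hi i hi (h + a) (by omega) (h + b) (by omega) hab).2
      omega⟩
  refine ⟨_, hp.isLeg, fun x hx => ?_⟩
  simp only [List.mem_map, List.mem_range] at hx
  obtain ⟨t, ht, rfl⟩ := hx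
  exact ⟨h + (t + 1), by omega, by omega, rfl⟩

theorem IsSegmentFamily.exists_isLeg_down {M n : ℕ} {σ : ℕ → ℕ → V} (hσ : IsSegmentFamily G M n σ)
    {i h k : ℕ} (hi : i < M) (hh : h ≤ 4 * n) (hk : k ≤ h) :
    ∃ l, IsLeg G k (σ i h) l ∧ ∀ x ∈ l, ∃ h', h ≤ h' + k ∧ h' < h ∧ x = σ i h' := by
  have hp : IsPathSeq G (k + 1) fun t => σ i (h - t) :=
    ⟨fun t ht => by
      have := (hσ.adj i hi (h - (t + 1)) (by omega)).symm
      rwa [show h - (t + 1) + 1 = h - t by omega] at this,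
    fun a ha b hb hab => by
      have := (hσ.inj i hi i hi (h - a) (by omega) (h - b) (by omega) hab).2
      omega⟩
  refine ⟨_, hp.isLeg, fun x hx => ?_⟩
  simp only [List.mem_map, List.mem_range] at hx
  obtain ⟨t, ht, rfl⟩ := hx
  exact ⟨h - (t + 1), by omega, by omega, rfl⟩

/-- A walk to a vertex of `X` contains a path that meets `X` only in its last vertex. -/
theorem exists_path_to_first_hit (X : Set V) {u x : V} (q : G.Walk u x) (hx : x ∈ X) :
    ∃ (l : List V) (y : V), y ∈ X ∧ (l ++ [y]).IsChain G.Adj ∧ (l ++ [y]).Nodup ∧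
      (l ++ [y]).head? = some u ∧ (∀ z ∈ l, z ∉ X) ∧ ∀ z ∈ l ++ [y], z ∈ q.support := by
  induction q with
  | nil => exact ⟨[], _, hx, by simp, by simp, by simp, by simp, by simp⟩
  | @cons u v x h q ih =>
    obtain ⟨l, y, hy, hc, hn, hh, hX, hs⟩ := ih hx
    by_cases huX : u ∈ X
    · exact ⟨[], u, huX, by simp, by simp, by simp, by simp, by simp⟩
    -- If the path found so far returns to `u`, the loop is cut off.
    by_cases hul : u ∈ l
    · obtain ⟨l₁, l₂, rfl⟩ := List.append_of_mem hul
      rw [List.append_assoc] at hc hn hs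
      refine ⟨u :: l₂, y, hy, hc.right_of_append, hn.of_append_right, by simp, ?_, ?_⟩
      · exact fun z hz => hX z (List.mem_append_right _ hz)
      · exact fun z hz => List.mem_cons_of_mem _ (hs z (List.mem_append_right _ hz))
    · refine ⟨u :: l, y, hy, ?_, ?_, by simp, ?_, ?_⟩
      · rw [List.cons_append, List.isChain_cons]
        refine ⟨fun z hz => ?_, hc⟩
        rw [hh] at hz
        cases hz
        exact h
      · rw [List.cons_append, List.nodup_cons]
        refine ⟨fun hmem => ?_, hn⟩
        rcases List.mem_append.mp hmem with h' | h'
        · exact hul h'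
        · rw [List.mem_singleton] at h'
          exact huX (h' ▸ hy)
      · intro z hz
        rcases List.mem_cons.mp hz with rfl | hz
        · exact huX
        · exact hX z hz
      · intro z hz
        rw [SimpleGraph.Walk.support_cons, List.mem_cons]
        rcases List.mem_cons.mp hz with rfl | hz
        · exact Or.inl rfl
        · exact Or.inr (hs z hz)

open Classical in
/-- The segments whose centre can be reached from `u` by a walk with at most `t` edges. -/
noncomputable def segmentsWithin (G : SimpleGraph V) (M n : ℕ) (σ : ℕ → ℕ → V) (t : ℕ) (u : V) :
    Finset ℕ :=
  (Finset.range M).filter fun i => ∃ q : G.Walk u (σ i (2 * n)), q.length ≤ t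

theorem mem_segmentsWithin {M n t i : ℕ} {σ : ℕ → ℕ → V} {u : V} :
    i ∈ segmentsWithin G M n σ t u ↔ i < M ∧ ∃ q : G.Walk u (σ i (2 * n)), q.length ≤ t := by
  simp [segmentsWithin]

theorem segmentsWithin_mono {M n : ℕ} {σ : ℕ → ℕ → V} {u : V} {t t' : ℕ} (h : t ≤ t') :
    segmentsWithin G M n σ t u ⊆ segmentsWithin G M n σ t' u := fun i hi => by
  rw [mem_segmentsWithin] at hi ⊢
  exact ⟨hi.1, hi.2.imp fun q hq => hq.trans h⟩

/-- A walk missing `S`, followed up to its first vertex on the segment and then along the longer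
part of the segment, would contain a leg from `u` that avoids `S`. -/
theorem IsSegmentFamily.exists_hit {M n : ℕ} {σ : ℕ → ℕ → V} (hσ : IsSegmentFamily G M n σ)
    {u : V} {S : Finset V} (hu : u ∉ S) (hS : ∀ l, IsLeg G n u l → ∃ x ∈ l, x ∈ S) {i : ℕ}
    (hi : i < M) (hui : ∀ h ≤ 4 * n, σ i h ≠ u) (hSi : ∀ h ≤ 4 * n, σ i h ∉ S)
    (q : G.Walk u (σ i (2 * n))) : ∃ x ∈ S, x ∈ q.support := by
  by_contra! hcon
  let X : Set V := {x | ∃ h ≤ 4 * n, x = σ i h}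
  obtain ⟨l, y, ⟨h, hh, rfl⟩, hc, hn, hhead, hX, hs⟩ :=
    exists_path_to_first_hit X q ⟨2 * n, by omega, rfl⟩
  obtain ⟨r, k, hr, hk, hrX⟩ : ∃ r k, IsLeg G k (σ i h) r ∧ n ≤ k ∧ ∀ x ∈ r, x ∈ X := by
    rcases le_total h (2 * n) with h' | h'
    · obtain ⟨r, hr, hr'⟩ := hσ.exists_isLeg_up (h := h) (k := 2 * n) hi (by omega)
      exact ⟨r, _, hr, by omega, fun x hx => by
        obtain ⟨a, -, ha, rfl⟩ := hr' x hx
        exact ⟨a, by omega, rfl⟩⟩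
    · obtain ⟨r, hr, hr'⟩ := hσ.exists_isLeg_down (h := h) (k := 2 * n) hi hh h'
      exact ⟨r, _, hr, by omega, fun x hx => by
        obtain ⟨a, -, ha, rfl⟩ := hr' x hx
        exact ⟨a, by omega, rfl⟩⟩
  rcases l with _ | ⟨u', l⟩
  · simp only [List.nil_append, List.head?_cons, Option.some.injEq] at hhead
    exact hui h hh hhead
  · simp only [List.cons_append, List.head?_cons, Option.some.injEq] at hhead
    subst hhead
    have hchain : (u' :: (l ++ σ i h :: r)).IsChain G.Adj := by
      have := hc.append_overlap (l₂ := [σ i h]) (l₃ := r) hr.chain (by simp)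
      simpa using this
    have hnodup : (u' :: (l ++ σ i h :: r)).Nodup := by
      have : ((u' :: l) ++ σ i h :: r).Nodup := by
        rw [List.nodup_append]
        refine ⟨hn.of_append_left, hr.nodup, fun a ha b hb hab => ?_⟩
        subst hab
        refine hX a ha ?_
        rcases List.mem_cons.mp hb with rfl | hb
        · exact ⟨h, hh, rfl⟩
        · exact hrX a hb
      exact this
    have hleg := isLeg_take hchain hnodup (n := n) (by
      have := hr.length_eq
      simp only [List.length_append, List.length_cons]
      omega)
    obtain ⟨x, hx, hxS⟩ := hS _ hleg
    have hx := List.mem_of_mem_take hx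
    rw [List.mem_append, List.mem_cons] at hx
    rcases hx with hx | rfl | hx
    · exact hcon x hxS (hs x (by simp [hx]))
    · exact hSi h hh hxS
    · obtain ⟨a, ha, rfl⟩ := hrX x hx
      exact hSi a ha hxS

theorem IsSegmentFamily.card_meeting_le {M n : ℕ} {σ : ℕ → ℕ → V} (hσ : IsSegmentFamily G M n σ)
    (I : Finset ℕ) (hI : ∀ i ∈ I, i < M) (S : Finset V)
    (hS : ∀ i ∈ I, ∃ h ≤ 4 * n, σ i h ∈ S) : I.card ≤ S.card := by
  choose! h hh hhS using hS
  refine Finset.card_le_card_of_injOn (fun i => σ i (h i)) hhS fun i hi j hj hij => ?_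
  exact (hσ.inj i (hI i hi) j (hI j hj) _ (hh i hi) _ (hh j hj) hij).1

/-- If `u` is not rich and many segments are close to `u`, then many of these segments are closer
to another vertex on the way. -/
theorem IsSegmentFamily.exists_closer {M n s : ℕ} {σ : ℕ → ℕ → V} (hσ : IsSegmentFamily G M n σ)
    {u : V} (hu : ¬ IsRich G s n u) {t N : ℕ}
    (hN : s * N + s + 1 < (segmentsWithin G M n σ t u).card) :
    ∃ u', (G.Adj u u' ∧ N < (segmentsWithin G M n σ (t - 1) u').card) ∨
      N < (segmentsWithin G M n σ (t - 2) u').card := by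
  classical
  unfold IsRich at hu
  push Not at hu
  obtain ⟨S, hScard, huS, hS⟩ := hu
  set A := segmentsWithin G M n σ t u with hA
  have hAM : ∀ i ∈ A, i < M := fun i hi => (mem_segmentsWithin.mp hi).1
  -- The segments that meet `S` or contain `u` are set aside; being disjoint, they number at most s
  -- + 1.
  set B := A.filter fun i => ∃ h ≤ 4 * n, σ i h ∈ insert u S with hB
  have hBcard : B.card ≤ s + 1 :=
    (hσ.card_meeting_le B (fun i hi => hAM i (Finset.mem_filter.mp hi).1) (insert u S)
      fun i hi => (Finset.mem_filter.mp hi).2).trans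
      ((Finset.card_insert_le _ _).trans (by omega))
  have hhit : ∀ i ∈ A \ B, ∃ x ∈ S, ∃ q : G.Walk u (σ i (2 * n)), q.length ≤ t ∧
      x ∈ q.support := by
    intro i hi
    rw [Finset.mem_sdiff] at hi
    obtain ⟨hiM, q, hq⟩ := mem_segmentsWithin.mp hi.1
    have hni : ∀ h ≤ 4 * n, σ i h ∉ insert u S := fun h hh hmem =>
      hi.2 (Finset.mem_filter.mpr ⟨hi.1, h, hh, hmem⟩)
    obtain ⟨x, hx, hxq⟩ := hσ.exists_hit huS hS hiM
      (fun h hh he => hni h hh (he ▸ Finset.mem_insert_self _ _))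
      (fun h hh he => hni h hh (Finset.mem_insert_of_mem he)) q
    exact ⟨x, hx, q, hq, hxq⟩
  have : Nonempty V := ⟨u⟩
  choose! f hfS hf using hhit
  have hcard : S.card * N < (A \ B).card := by
    have h1 := Finset.le_card_sdiff B A
    have h2 := Nat.mul_le_mul_right N hScard
    omega
  -- Pigeonhole: one vertex of `S` lies on the chosen walks to more than `N` segments. It differs
  -- from `u`, so what remains of each walk is shorter by at least 1, and by at least 2 if it is not
  -- a neighbour of `u`.
  obtain ⟨x, hxS, hx⟩ := Finset.exists_lt_card_fiber_of_mul_lt_card_of_maps_to hfS hcard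
  have hxu : u ≠ x := fun h => huS (h ▸ hxS)
  refine ⟨x, ?_⟩
  have hsplit : ∀ i ∈ (A \ B).filter fun i => f i = x, i < M ∧
      ∃ (p : G.Walk u x) (r : G.Walk x (σ i (2 * n))), p.length + r.length ≤ t := by
    intro i hi
    obtain ⟨hiAB, rfl⟩ := Finset.mem_filter.mp hi
    obtain ⟨q, hq, hmem⟩ := hf i hiAB
    refine ⟨hAM i (Finset.mem_sdiff.mp hiAB).1, q.takeUntil _ hmem, q.dropUntil _ hmem, ?_⟩
    rw [← SimpleGraph.Walk.length_append, q.take_spec hmem]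
    exact hq
  have hpos : ∀ p : G.Walk u x, 1 ≤ p.length := fun p => by
    by_contra! h
    exact hxu (p.eq_of_length_eq_zero (by omega))
  by_cases hadj : G.Adj u x
  · left
    refine ⟨hadj, hx.trans_le (Finset.card_le_card fun i hi => ?_)⟩
    obtain ⟨hiM, p, r, hpr⟩ := hsplit i hi
    have := hpos p
    exact mem_segmentsWithin.mpr ⟨hiM, r, by omega⟩
  · right
    refine hx.trans_le (Finset.card_le_card fun i hi => ?_)
    obtain ⟨hiM, p, r, hpr⟩ := hsplit i hi
    have := hpos p
    have : p.length ≠ 1 := fun h => hadj (SimpleGraph.Walk.adj_of_length_eq_one h)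
    exact mem_segmentsWithin.mpr ⟨hiM, r, by omega⟩

/-- A bound for the number of segments within distance `t` of a vertex if no vertex is rich. -/
def segmentBound (s : ℕ) : ℕ → ℕ
  | 0 => 1
  | t + 1 => s * segmentBound s t + s + 1

/-- A violation at distance t + 1 passes down to distance t by `exists_closer`; at distance 0 a
vertex is the centre of at most one segment. -/
theorem IsSegmentFamily.card_segmentsWithin_le {M n s : ℕ} {σ : ℕ → ℕ → V}
    (hσ : IsSegmentFamily G M n σ) (h : ∀ u, ¬ IsRich G s n u) (t : ℕ) (u : V) :
    (segmentsWithin G M n σ t u).card ≤ segmentBound s t := by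
  induction t generalizing u with
  | zero =>
    refine hσ.card_meeting_le _ (fun i hi => (mem_segmentsWithin.mp hi).1) {u} fun i hi => ?_
    obtain ⟨-, q, hq⟩ := mem_segmentsWithin.mp hi
    exact ⟨2 * n, by omega, by
      rw [Finset.mem_singleton]; exact (q.eq_of_length_eq_zero (by omega)).symm⟩
  | succ t ih =>
    by_contra! hcon
    obtain ⟨u', ⟨-, h'⟩ | h'⟩ := hσ.exists_closer (h u) hcon
    · exact absurd (ih u') (by simpa using h')
    · have h1 := Finset.card_le_card (segmentsWithin_mono (G := G) (M := M) (n := n) (σ := σ)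
        (u := u') (t := t + 1 - 2) (t' := t) (by omega))
      have := ih u'
      omega

theorem exists_walk_length_le {k : ℕ} (h : G.ediam ≤ k) (u v : V) :
    ∃ q : G.Walk u v, q.length ≤ k := by
  have h1 : G.edist u v ≤ k := SimpleGraph.edist_le_ediam.trans h
  have hr : G.Reachable u v := SimpleGraph.reachable_of_edist_ne_top fun h' => by
    rw [h'] at h1
    exact absurd h1 (by simp)
  obtain ⟨q, hq⟩ := hr.exists_walk_length_eq_edist
  exact ⟨q, by rw [← hq] at h1; exact_mod_cast h1⟩

theorem segmentsWithin_eq_range {k : ℕ} (h : G.ediam ≤ k) (M n : ℕ) (σ : ℕ → ℕ → V) (u : V) :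
    segmentsWithin G M n σ k u = Finset.range M := by
  ext i
  simp [mem_segmentsWithin, exists_walk_length_le h u]

theorem subdividedStar_isContained_of_isPathSeq {k n : ℕ} {len : Fin k → ℕ} (hlen : ∀ i, len i ≤ n)
    (h : G.ediam ≤ 4) {p : ℕ → V}
    (hp : IsPathSeq G ((segmentBound (k * n) 4 + 1) * (4 * n + 1)) p) :
    subdividedStar k len ⊑ G := by
  by_contra hcon
  have hσ := hp.isSegmentFamily
  have := hσ.card_segmentsWithin_le (s := k * n)
    (fun u hu => hcon (hu.subdividedStar_isContained hlen le_rfl)) 4 (p 0)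
  rw [segmentsWithin_eq_range (k := 4) h, Finset.card_range] at this
  omega

end Segments

/-! ### Finding the H-graph from rich vertices and segments -/

section TwoCentres

variable {V : Type*} {G : SimpleGraph V}

theorem subdividedH_isContained_of_legs {n : ℕ} {a m b : V} {l₁ l₂ l₃ l₄ : List V}
    (ham : G.Adj a m) (hbm : G.Adj b m) (hab : a ≠ b) (h₁ : IsLeg G n a l₁) (h₂ : IsLeg G n a l₂)
    (h₃ : IsLeg G n b l₃) (h₄ : IsLeg G n b l₄) (hm : m ∉ l₁ ∧ m ∉ l₂ ∧ m ∉ l₃ ∧ m ∉ l₄)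
    (ha : a ∉ l₃ ∧ a ∉ l₄) (hb : b ∉ l₁ ∧ b ∉ l₂) (h₁₂ : l₁.Disjoint l₂) (h₁₃ : l₁.Disjoint l₃)
    (h₁₄ : l₁.Disjoint l₄) (h₂₃ : l₂.Disjoint l₃) (h₂₄ : l₂.Disjoint l₄) (h₃₄ : l₃.Disjoint l₄) :
    subdividedH 2 n ⊑ G := by
  refine subdividedH_isContained (fun s => cond s b a) m
    (fun s t => cond s (cond t l₄ l₃) (cond t l₂ l₁)) hab ?_ ?_ ?_ ?_ ?_
  · rintro (_ | _)
    exacts [ham, hbm]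
  · rintro (_ | _) (_ | _)
    exacts [h₁, h₂, h₃, h₄]
  · rintro (_ | _) (_ | _)
    exacts [hm.1, hm.2.1, hm.2.2.1, hm.2.2.2]
  · rintro (_ | _) (_ | _)
    exacts [hb.1, hb.2, ha.1, ha.2]
  · rintro (_ | _) (_ | _) (_ | _) (_ | _) h
    exacts [absurd rfl h, h₁₂, h₁₃, h₁₄, h₁₂.symm, absurd rfl h, h₂₃, h₂₄, h₁₃.symm, h₂₃.symm,
      absurd rfl h, h₃₄, h₁₄.symm, h₂₄.symm, h₃₄.symm, absurd rfl h]

/-- The vertex `u` is the middle of the copy, and each segment supplies two legs in opposite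
directions. -/
theorem IsSegmentFamily.subdividedH_isContained {M n : ℕ} {σ : ℕ → ℕ → V}
    (hσ : IsSegmentFamily G M n σ) {i j h k : ℕ} {u : V} (hi : i < M) (hj : j < M) (hij : i ≠ j)
    (hh : n ≤ h ∧ h ≤ 3 * n) (hk : n ≤ k ∧ k ≤ 3 * n) (hui : ∀ x ≤ 4 * n, σ i x ≠ u)
    (huj : ∀ x ≤ 4 * n, σ j x ≠ u) (h₁ : G.Adj u (σ i h)) (h₂ : G.Adj u (σ j k)) :
    subdividedH 2 n ⊑ G := by
  obtain ⟨l₁, hl₁, m₁⟩ := hσ.exists_isLeg_up (h := h) (k := n) hi (by omega)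
  obtain ⟨l₂, hl₂, m₂⟩ := hσ.exists_isLeg_down (h := h) (k := n) hi (by omega) (by omega)
  obtain ⟨l₃, hl₃, m₃⟩ := hσ.exists_isLeg_up (h := k) (k := n) hj (by omega)
  obtain ⟨l₄, hl₄, m₄⟩ := hσ.exists_isLeg_down (h := k) (k := n) hj (by omega) (by omega)
  have ne : ∀ x ≤ 4 * n, ∀ y ≤ 4 * n, σ i x ≠ σ j y := fun x hx y hy e =>
    hij (hσ.inj i hi j hj x hx y hy e).1
  have same : ∀ i < M, ∀ x ≤ 4 * n, ∀ y ≤ 4 * n, σ i x = σ i y → x = y := fun i hi x hx y hy e =>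
    (hσ.inj i hi i hi x hx y hy e).2
  refine subdividedH_isContained_of_legs h₁.symm h₂.symm (ne _ (by omega) _ (by omega)) hl₁ hl₂ hl₃
    hl₄ ⟨?_, ?_, ?_, ?_⟩ ⟨?_, ?_⟩ ⟨?_, ?_⟩ ?_ ?_ ?_ ?_ ?_ ?_
  · intro hx
    obtain ⟨a, _, _, e⟩ := m₁ _ hx
    exact hui a (by omega) e.symm
  · intro hx
    obtain ⟨a, _, _, e⟩ := m₂ _ hx
    exact hui a (by omega) e.symm
  · intro hx
    obtain ⟨a, _, _, e⟩ := m₃ _ hx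
    exact huj a (by omega) e.symm
  · intro hx
    obtain ⟨a, _, _, e⟩ := m₄ _ hx
    exact huj a (by omega) e.symm
  · intro hx
    obtain ⟨a, _, _, e⟩ := m₃ _ hx
    exact ne _ (by omega) _ (by omega) e
  · intro hx
    obtain ⟨a, _, _, e⟩ := m₄ _ hx
    exact ne _ (by omega) _ (by omega) e
  · intro hx
    obtain ⟨a, _, _, e⟩ := m₁ _ hx
    exact ne _ (by omega) _ (by omega) e.symm
  · intro hx
    obtain ⟨a, _, _, e⟩ := m₂ _ hx
    exact ne _ (by omega) _ (by omega) e.symm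
  · intro x hx hy
    obtain ⟨a, _, _, rfl⟩ := m₁ _ hx
    obtain ⟨b, _, _, e⟩ := m₂ _ hy
    have := same i hi a (by omega) b (by omega) e
    omega
  · intro x hx hy
    obtain ⟨a, _, _, rfl⟩ := m₁ _ hx
    obtain ⟨b, _, _, e⟩ := m₃ _ hy
    exact ne _ (by omega) _ (by omega) e
  · intro x hx hy
    obtain ⟨a, _, _, rfl⟩ := m₁ _ hx
    obtain ⟨b, _, _, e⟩ := m₄ _ hy
    exact ne _ (by omega) _ (by omega) e
  · intro x hx hy
    obtain ⟨a, _, _, rfl⟩ := m₂ _ hx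
    obtain ⟨b, _, _, e⟩ := m₃ _ hy
    exact ne _ (by omega) _ (by omega) e
  · intro x hx hy
    obtain ⟨a, _, _, rfl⟩ := m₂ _ hx
    obtain ⟨b, _, _, e⟩ := m₄ _ hy
    exact ne _ (by omega) _ (by omega) e
  · intro x hx hy
    obtain ⟨a, _, _, rfl⟩ := m₃ _ hx
    obtain ⟨b, _, _, e⟩ := m₄ _ hy
    have := same j hj a (by omega) b (by omega) e
    omega

/-- Richness supplies the two legs at `v`; the second must avoid `m`, `b` and three legs of n
vertices, hence 3n + 2. -/
theorem IsRich.subdividedH_isContained {s n : ℕ} (hs : 3 * n + 2 ≤ s) {v m b : V}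
    (hv : IsRich G s n v) (hvm : G.Adj v m) (hbm : G.Adj b m) (hvb : v ≠ b) {l₃ l₄ : List V}
    (h₃ : IsLeg G n b l₃) (h₄ : IsLeg G n b l₄) (h₃₄ : l₃.Disjoint l₄) (hv₃ : v ∉ l₃) (hv₄ : v ∉ l₄)
    (hm₃ : m ∉ l₃) (hm₄ : m ∉ l₄) : subdividedH 2 n ⊑ G := by
  classical
  have c₃ := List.toFinset_card_le l₃
  have c₄ := List.toFinset_card_le l₄
  rw [h₃.length_eq] at c₃
  rw [h₄.length_eq] at c₄
  obtain ⟨l₁, h₁, a₁⟩ := hv (insert m (insert b (l₃.toFinset ∪ l₄.toFinset))) (by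
      have := Finset.card_union_le l₃.toFinset l₄.toFinset
      have := Finset.card_insert_le b (l₃.toFinset ∪ l₄.toFinset)
      have := Finset.card_insert_le m (insert b (l₃.toFinset ∪ l₄.toFinset))
      omega)
    (by simp [hvm.ne, hvb, hv₃, hv₄])
  have c₁ := List.toFinset_card_le l₁
  rw [h₁.length_eq] at c₁
  obtain ⟨l₂, h₂, a₂⟩ := hv (insert m (insert b (l₁.toFinset ∪ (l₃.toFinset ∪ l₄.toFinset)))) (by
      have := Finset.card_union_le l₃.toFinset l₄.toFinset
      have := Finset.card_union_le l₁.toFinset (l₃.toFinset ∪ l₄.toFinset)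
      have := Finset.card_insert_le b (l₁.toFinset ∪ (l₃.toFinset ∪ l₄.toFinset))
      have := Finset.card_insert_le m (insert b (l₁.toFinset ∪ (l₃.toFinset ∪ l₄.toFinset)))
      omega)
    (by simp [hvm.ne, hvb, hv₃, hv₄, h₁.notMem])
  simp only [Finset.mem_insert, Finset.mem_union, List.mem_toFinset, not_or] at a₁ a₂
  exact subdividedH_isContained_of_legs hvm hbm hvb h₁ h₂ h₃ h₄
    ⟨fun h => (a₁ m h).1 rfl, fun h => (a₂ m h).1 rfl, hm₃, hm₄⟩ ⟨hv₃, hv₄⟩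
    ⟨fun h => (a₁ b h).2.1 rfl, fun h => (a₂ b h).2.1 rfl⟩
    (fun x h h' => (a₂ x h').2.2.1 h) (fun x h h' => (a₁ x h).2.2.1 h')
    (fun x h h' => (a₁ x h).2.2.2 h') (fun x h h' => (a₂ x h).2.2.2.1 h')
    (fun x h h' => (a₂ x h).2.2.2.2 h') h₃₄

theorem IsRich.eq_of_common_neighbor {s n : ℕ} (hs : 3 * n + 2 ≤ s)
    (hH : ¬ subdividedH 2 n ⊑ G) {v b m : V} (hv : IsRich G s n v) (hb : IsRich G s n b)
    (hvm : G.Adj v m) (hbm : G.Adj b m) : v = b := by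
  classical
  by_contra hne
  obtain ⟨l₃, h₃, a₃⟩ := hb {v, m} ((Finset.card_insert_le _ _).trans (by simp; omega))
    (by simp [Ne.symm hne, hbm.ne])
  have c₃ := List.toFinset_card_le l₃
  rw [h₃.length_eq] at c₃
  obtain ⟨l₄, h₄, a₄⟩ := hb (insert v (insert m l₃.toFinset)) (by
      have := Finset.card_insert_le m l₃.toFinset
      have := Finset.card_insert_le v (insert m l₃.toFinset)
      omega)
    (by simp [Ne.symm hne, hbm.ne, h₃.notMem])
  simp only [Finset.mem_insert, Finset.mem_singleton, List.mem_toFinset, not_or] at a₃ a₄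
  exact hH (hv.subdividedH_isContained hs hvm hbm hne h₃ h₄ (fun x h h' => (a₄ x h').2.2 h)
    (fun h => (a₃ v h).1 rfl) (fun h => (a₄ v h).1 rfl) (fun h => (a₃ m h).2 rfl)
    (fun h => (a₄ m h).2.1 rfl))

/-- A path from `b` to a rich vertex extends to a leg. -/
theorem IsRich.exists_isLeg_of_path {s n : ℕ} {b r : V} (hr : IsRich G s n r) {q : List V}
    (hc : (b :: (q ++ [r])).IsChain G.Adj) (hn : (b :: (q ++ [r])).Nodup) (S : Finset V)
    (hS : S.card + q.length + 1 ≤ s) (hq : ∀ x ∈ q ++ [r], x ∉ S) :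
    ∃ l, IsLeg G n b l ∧ ∀ x ∈ l, x ∉ S := by
  classical
  obtain ⟨l, hl, hlS⟩ := hr (S ∪ (b :: q).toFinset) (by
      have := Finset.card_union_le S (b :: q).toFinset
      have := List.toFinset_card_le (b :: q)
      rw [List.length_cons] at this
      omega)
    (by
      rw [Finset.mem_union, List.mem_toFinset]
      rintro (h | h)
      · exact hq r (by simp) h
      · have : ((b :: q) ++ [r]).Nodup := hn
        exact (List.nodup_append.mp this).2.2 r h r (by simp) rfl)
  have hchain : (b :: (q ++ r :: l)).IsChain G.Adj := by
    have := List.IsChain.append_overlap (l₁ := b :: q) (l₂ := [r]) (l₃ := l) hc hl.chain (by simp)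
    simpa using this
  have hnodup : ((b :: q) ++ r :: l).Nodup := by
    rw [List.nodup_append]
    have h' : ((b :: q) ++ [r]).Nodup := hn
    refine ⟨h'.of_append_left, hl.nodup, fun x hx y hy hxy => ?_⟩
    subst hxy
    rcases List.mem_cons.mp hy with rfl | hy
    · exact (List.nodup_append.mp h').2.2 x hx x (by simp) rfl
    · exact hlS x hy (Finset.mem_union_right _ (List.mem_toFinset.mpr hx))
  refine ⟨_, isLeg_take hchain hnodup (n := n) (by
    have := hl.length_eq
    simp only [List.length_append, List.length_cons]
    omega), fun x hx => ?_⟩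
  have hx := List.mem_of_mem_take hx
  rw [List.mem_append, List.mem_cons] at hx
  rcases hx with hx | rfl | hx
  · exact hq x (by simp [hx])
  · exact hq x (by simp)
  · exact fun h => hlS x hx (Finset.mem_union_left _ h)

/-- A vertex with paths to three rich vertices that share nothing else, one of them with two
edges and one with a single edge, yields a copy of `subdividedH 2 n`. -/
theorem subdividedH_isContained_of_three_rich {s n : ℕ} (hs : 3 * n + 20 ≤ s) {r₁ m b r₂ r₃ : V}
    {q : List V} (hr₁ : IsRich G s n r₁) (hr₂ : IsRich G s n r₂) (hr₃ : IsRich G s n r₃)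
    (h₁ : G.Adj r₁ m) (hm : G.Adj b m) (h₂ : G.Adj b r₂)
    (hc : (b :: (q ++ [r₃])).IsChain G.Adj) (hn : (b :: (q ++ [r₃])).Nodup) (hq : q.length ≤ 10)
    (hr₁q : r₁ ∉ q ++ [r₃]) (hr₂q : r₂ ∉ q ++ [r₃]) (hmq : m ∉ q ++ [r₃])
    (h₁b : r₁ ≠ b) (h₁₂ : r₁ ≠ r₂) (hm₂ : m ≠ r₂) : subdividedH 2 n ⊑ G := by
  classical
  have cq := List.toFinset_card_le (q ++ [r₃])
  rw [List.length_append, List.length_singleton] at cq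
  -- The centres of the copy are `r₁` and `b`. The leg from `b` through `r₂` is kept off the path to
  -- `r₃`, so that the other leg at `b` can follow that path.
  obtain ⟨l₃, h₃, a₃⟩ := hr₂.exists_isLeg_of_path (q := []) (b := b) (by simpa using h₂)
    (by simpa using h₂.ne) (insert r₁ (insert m (q ++ [r₃]).toFinset)) (by
      have := Finset.card_insert_le m (q ++ [r₃]).toFinset
      have := Finset.card_insert_le r₁ (insert m (q ++ [r₃]).toFinset)
      rw [List.length_nil]
      omega)
    (by
      intro x hx
      obtain rfl : x = r₂ := by simpa using hx
      rw [Finset.mem_insert, Finset.mem_insert, List.mem_toFinset]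
      rintro (h | h | h)
      exacts [h₁₂ h.symm, hm₂ h.symm, hr₂q h])
  simp only [Finset.mem_insert, List.mem_toFinset, not_or] at a₃
  have c₃ := List.toFinset_card_le l₃
  rw [h₃.length_eq] at c₃
  obtain ⟨l₄, h₄, a₄⟩ := hr₃.exists_isLeg_of_path hc hn (insert r₁ (insert m l₃.toFinset)) (by
      have := Finset.card_insert_le m l₃.toFinset
      have := Finset.card_insert_le r₁ (insert m l₃.toFinset)
      omega)
    (by
      intro x hx
      rw [Finset.mem_insert, Finset.mem_insert, List.mem_toFinset]
      rintro (rfl | rfl | h)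
      exacts [hr₁q hx, hmq hx, (a₃ x h).2.2 hx])
  simp only [Finset.mem_insert, List.mem_toFinset, not_or] at a₄
  exact hr₁.subdividedH_isContained (by omega) h₁ hm h₁b h₃ h₄ (fun x h h' => (a₄ x h').2.2 h)
    (fun h => (a₃ _ h).1 rfl) (fun h => (a₄ _ h).1 rfl) (fun h => (a₃ _ h).2.1 rfl)
    (fun h => (a₄ _ h).2.1 rfl)

/-- If an edge joins neighbours of different rich vertices, then from its ends no third rich
vertex can be reached by a short walk through vertices that are not rich. -/
theorem rich_eq_or_eq_of_walk {s n : ℕ} (hs : 3 * n + 20 ≤ s) (hH : ¬ subdividedH 2 n ⊑ G)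
    {b c y ρb ρc ρy : V} (hbc : G.Adj b c) (hc : ¬ IsRich G s n c) (p : G.Walk b y)
    (hp : ∀ z ∈ p.support, ¬ IsRich G s n z) (hlen : p.length ≤ 4) (hρb : IsRich G s n ρb)
    (hρc : IsRich G s n ρc) (hρy : IsRich G s n ρy) (hb' : G.Adj ρb b) (hc' : G.Adj ρc c)
    (hy' : G.Adj ρy y) (hne : ρb ≠ ρc) : ρy = ρb ∨ ρy = ρc := by
  classical
  -- If the path avoids `c`, then `b` reaches `ρb` directly, `ρc` through `c`, and `ρy` along the
  -- path; three different ends would give the H-graph.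
  have main : ∀ {b c ρb ρc : V}, G.Adj b c → ¬ IsRich G s n c → ∀ p : G.Walk b y, p.IsPath →
      (∀ z ∈ p.support, ¬ IsRich G s n z) → p.length ≤ 4 → IsRich G s n ρb → IsRich G s n ρc →
      G.Adj ρb b → G.Adj ρc c → ρb ≠ ρc → c ∉ p.support → ρy = ρb ∨ ρy = ρc := by
    intro b c ρb ρc hbc hc p hpath hp hlen hρb hρc hb' hc' hne hcp
    by_contra! hcon
    obtain ⟨t, ht⟩ : ∃ t, p.support = b :: t := ⟨_, (p.cons_tail_support).symm⟩
    have hchain : (b :: (t ++ [ρy])).IsChain G.Adj := by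
      rw [← List.cons_append, ← ht, List.isChain_append]
      refine ⟨p.isChain_adj_support, by simp, fun x hx z hz => ?_⟩
      have h1 : p.support.getLast? = some y := by
        rw [List.getLast?_eq_some_getLast p.support_ne_nil, p.getLast_support]
      rw [h1] at hx
      cases hx
      cases hz
      exact hy'.symm
    have hnotin : ∀ z, IsRich G s n z → z ∉ p.support := fun z hz hz' => hp z hz' hz
    have hnodup : (b :: (t ++ [ρy])).Nodup := by
      rw [← List.cons_append, ← ht, List.nodup_append]
      refine ⟨hpath.support_nodup, by simp, fun x hx z hz => ?_⟩
      rw [List.mem_singleton] at hz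
      rintro rfl
      exact hnotin _ (hz ▸ hρy) hx
    have htl : ∀ x, x ∉ p.support → x ≠ ρy → x ∉ t ++ [ρy] := by
      intro x hx hxy h
      rw [ht] at hx
      simp only [List.mem_append, List.mem_singleton] at h
      rcases h with h | h
      · exact hx (List.mem_cons_of_mem _ h)
      · exact hxy h
    have hlt : t.length ≤ 10 := by
      have h1 := p.length_support
      rw [ht, List.length_cons] at h1
      omega
    refine hH (subdividedH_isContained_of_three_rich hs hρc hρb hρy hc' hbc hb'.symm hchain hnodup
      hlt (htl _ (hnotin _ hρc) hcon.2.symm) (htl _ (hnotin _ hρb) hcon.1.symm)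
      (htl _ hcp fun h => hc (h ▸ hρy)) ?_ hne.symm (fun h => hc (h ▸ hρb)))
    intro h
    exact hp b p.start_mem_support (h ▸ hρc)
  have hq : ∀ z ∈ p.bypass.support, ¬ IsRich G s n z := fun z hz =>
    hp z (p.support_bypass_subset_support hz)
  have hql := p.length_bypass_le_length.trans hlen
  have hqp := p.bypass_isPath
  -- If the path visits `c`, the roles of `b` and `c` are exchanged and only the part after `c`,
  -- which misses `b`, is kept.
  by_cases hcp : c ∈ p.bypass.support
  · refine (main hbc.symm (hp b p.start_mem_support) (p.bypass.dropUntil c hcp)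
      (hqp.dropUntil hcp) (fun z hz => hq z (p.bypass.support_dropUntil_subset_support hcp hz))
      ((p.bypass.length_dropUntil_le_length hcp).trans hql) hρc hρb hc' hb' hne.symm ?_).symm
    have := hqp.support_nodup
    rw [← p.bypass.take_spec hcp, SimpleGraph.Walk.support_append, List.nodup_append] at this
    intro hmem
    rw [← (p.bypass.dropUntil c hcp).cons_tail_support] at hmem
    rcases List.mem_cons.mp hmem with h | h
    · exact hbc.ne h
    · exact this.2.2 b (SimpleGraph.Walk.start_mem_support _) b h rfl
  · exact main hbc hc p.bypass hqp hq hql hρb hρc hb' hc' hne hcp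

end TwoCentres

/-! ### Disjoint stars in diameter at most 4 -/

section Stars

variable {V : Type*} {G : SimpleGraph V} {R : V → Prop}

/-- Between two nonadjacent vertices of `R`, some edge outside `R` joins the star of one of them
(or of its neighbour in `R`) to that of the other. -/
theorem exists_crossing_edge (hdiam : ∀ u v, ∃ p : G.Walk u v, p.length ≤ 4)
    (hdom : ∀ u, ¬ R u → ∃ r, R r ∧ G.Adj r u)
    (huniq : ∀ r r' m, R r → R r' → G.Adj r m → G.Adj r' m → r = r')
    (hwalk : ∀ b c y ρb ρc ρy (p : G.Walk b y), G.Adj b c → ¬ R c → (∀ z ∈ p.support, ¬ R z) →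
      p.length ≤ 4 → R ρb → R ρc → R ρy → G.Adj ρb b → G.Adj ρc c → G.Adj ρy y → ρb ≠ ρc →
      ρy = ρb ∨ ρy = ρc)
    {r₁ r₂ : V} (h₁ : R r₁) (h₂ : R r₂) (hne : r₁ ≠ r₂) (hadj : ¬ G.Adj r₁ r₂) :
    ∃ x w ρ₁ ρ₂, ¬ R x ∧ ¬ R w ∧ G.Adj x w ∧ R ρ₁ ∧ R ρ₂ ∧ G.Adj ρ₁ x ∧ G.Adj ρ₂ w ∧ ρ₁ ≠ ρ₂ ∧
      (ρ₁ = r₁ ∨ G.Adj ρ₁ r₁) ∧ (ρ₂ = r₂ ∨ G.Adj ρ₂ r₂) := by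
  have hadj' : ¬ G.Adj r₂ r₁ := fun h => hadj h.symm
  obtain ⟨p, hp⟩ := hdiam r₁ r₂
  rcases p with _ | @⟨_, u₁, _, e₁, _ | @⟨_, u₂, _, e₂, _ | @⟨_, u₃, _, e₃, _ | @⟨_, u₄, _, e₄, p⟩⟩⟩⟩
  · exact absurd rfl hne
  · exact absurd e₁ hadj
  · exact absurd (huniq _ _ _ h₁ h₂ e₁ e₂.symm) hne
  · have n₁ : ¬ R u₁ := by
      intro hu₁
      by_cases hu₂ : R u₂
      · exact hadj (huniq _ _ _ h₁ hu₂ e₁ e₂.symm ▸ e₃)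
      · exact hadj (huniq _ _ _ hu₁ h₂ e₂ e₃.symm ▸ e₁)
    have n₂ : ¬ R u₂ := fun hu₂ => hadj (huniq _ _ _ h₁ hu₂ e₁ e₂.symm ▸ e₃)
    exact ⟨u₁, u₂, r₁, r₂, n₁, n₂, e₂, h₁, h₂, e₁, e₃.symm, hne, Or.inl rfl, Or.inl rfl⟩
  · obtain ⟨rfl, -⟩ : u₄ = r₂ ∧ True := by
      cases p with
      | nil => exact ⟨rfl, trivial⟩
      | cons h p => simp only [SimpleGraph.Walk.length_cons] at hp; omega
    have n₂ : ¬ R u₂ := fun hu₂ => by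
      have := huniq _ _ _ h₁ hu₂ e₁ e₂.symm
      have := huniq _ _ _ h₂ hu₂ e₄.symm e₃
      exact hne (by simp_all)
    by_cases n₁ : R u₁
    · have n₃ : ¬ R u₃ := fun hu₃ => by
        obtain rfl := huniq _ _ _ n₁ hu₃ e₂ e₃.symm
        exact hne (huniq _ _ _ h₁ h₂ e₁ e₄.symm)
      exact ⟨u₂, u₃, u₁, u₄, n₂, n₃, e₃, n₁, h₂, e₂, e₄.symm, fun h => hadj (h ▸ e₁),
        Or.inr e₁.symm, Or.inl rfl⟩
    by_cases n₃ : R u₃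
    · exact ⟨u₁, u₂, r₁, u₃, n₁, n₂, e₂, h₁, n₃, e₁, e₃.symm, fun h => hadj (h ▸ e₄),
        Or.inl rfl, Or.inr e₄⟩
    -- No inner vertex of the walk is in `R`. The vertex of `R` dominating `u₂` must be `r₁` or
    -- `r₂`, by `hwalk`, and this decides which middle edge of the walk crosses.
    obtain ⟨ρ, hρ, hρu⟩ := hdom u₂ n₂
    by_cases hρ₁ : ρ = r₁
    · subst hρ₁
      exact ⟨u₂, u₃, ρ, u₄, n₂, n₃, e₃, h₁, h₂, hρu, e₄.symm, hne, Or.inl rfl, Or.inl rfl⟩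
    · have := hwalk u₁ u₂ u₃ r₁ ρ u₄ (.cons e₂ (.cons e₃ .nil)) e₂ n₂ (by simp [n₁, n₂, n₃]) (by simp)
        h₁ hρ h₂ e₁ hρu e₄.symm (Ne.symm hρ₁)
      have hρ₂ : u₄ = ρ := this.resolve_left hne.symm
      subst hρ₂
      exact ⟨u₁, u₂, r₁, u₄, n₁, n₂, e₂, h₁, h₂, e₁, hρu, hne, Or.inl rfl, Or.inl rfl⟩

/-- On a walk of at most four edges from `x` to `x'`, the first vertex of `R` is `ρ₁` or `ρ₂` and
the last is `ρ₃` or `ρ₄`, by `hwalk` from both ends. They are equal, adjacent, or have a common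
neighbour and so are equal by `huniq`. If the walk avoids `R`, then `ρ₃` itself is `ρ₁` or `ρ₂`. -/
theorem false_of_two_crossing_edges (hdiam : ∀ u v, ∃ p : G.Walk u v, p.length ≤ 4)
    (huniq : ∀ r r' m, R r → R r' → G.Adj r m → G.Adj r' m → r = r')
    (hwalk : ∀ b c y ρb ρc ρy (p : G.Walk b y), G.Adj b c → ¬ R c → (∀ z ∈ p.support, ¬ R z) →
      p.length ≤ 4 → R ρb → R ρc → R ρy → G.Adj ρb b → G.Adj ρc c → G.Adj ρy y → ρb ≠ ρc →
      ρy = ρb ∨ ρy = ρc)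
    {x w ρ₁ ρ₂ x' w' ρ₃ ρ₄ : V} (hx : ¬ R x) (hw : ¬ R w) (hxw : G.Adj x w) (h₁ : R ρ₁) (h₂ : R ρ₂)
    (h₁x : G.Adj ρ₁ x) (h₂w : G.Adj ρ₂ w) (h₁₂ : ρ₁ ≠ ρ₂)
    (hx' : ¬ R x') (hw' : ¬ R w') (hxw' : G.Adj x' w') (h₃ : R ρ₃) (h₄ : R ρ₄)
    (h₃x : G.Adj ρ₃ x') (h₄w : G.Adj ρ₄ w') (h₃₄ : ρ₃ ≠ ρ₄)
    (hfar : ∀ ρ ρ', (ρ = ρ₁ ∨ ρ = ρ₂) → (ρ' = ρ₃ ∨ ρ' = ρ₄) → ρ ≠ ρ' ∧ ¬ G.Adj ρ ρ') : False := by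
  have near : ∀ {y ρ} (p : G.Walk x y), (∀ z ∈ p.support, ¬ R z) → p.length ≤ 4 → R ρ →
      G.Adj ρ y → ρ = ρ₁ ∨ ρ = ρ₂ := fun {y ρ} p hp hl hρ hy =>
    hwalk x w y ρ₁ ρ₂ ρ p hxw hw hp hl h₁ h₂ hρ h₁x h₂w hy h₁₂
  have near' : ∀ {y ρ} (p : G.Walk x' y), (∀ z ∈ p.support, ¬ R z) → p.length ≤ 4 → R ρ →
      G.Adj ρ y → ρ = ρ₃ ∨ ρ = ρ₄ := fun {y ρ} p hp hl hρ hy =>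
    hwalk x' w' y ρ₃ ρ₄ ρ p hxw' hw' hp hl h₃ h₄ hρ h₃x h₄w hy h₃₄
  obtain ⟨p, hp⟩ := hdiam x x'
  by_cases hall : ∀ z ∈ p.support, ¬ R z
  · exact (hfar ρ₃ ρ₃ (near p hall hp h₃ h₃x) (Or.inl rfl)).1 rfl
  rcases p with _ | @⟨_, u₁, _, e₁, _ | @⟨_, u₂, _, e₂, _ | @⟨_, u₃, _, e₃, _ | @⟨_, u₄, _, e₄, p⟩⟩⟩⟩
  · exact hall (by simpa using hx)
  · exact hall (by simp [hx, hx'])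
  · have n₁ : R u₁ := by simpa [hx, hx'] using hall
    exact (hfar u₁ u₁ (near .nil (by simpa using hx) (by simp) n₁ e₁.symm)
      (near' .nil (by simpa using hx') (by simp) n₁ e₂)).1 rfl
  · by_cases n₁ : R u₁
    · have m₁ := near .nil (by simpa using hx) (by simp) n₁ e₁.symm
      by_cases n₂ : R u₂
      · exact (hfar u₁ u₂ m₁ (near' .nil (by simpa using hx') (by simp) n₂ e₃)).2 e₂
      · exact (hfar u₁ u₁ m₁ (near' (.cons e₃.symm .nil) (by simp [hx', n₂]) (by simp) n₁ e₂)).1 rfl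
    · have n₂ : R u₂ := by simpa [hx, hx', n₁] using hall
      exact (hfar u₂ u₂ (near (.cons e₁ .nil) (by simp [hx, n₁]) (by simp) n₂ e₂.symm)
        (near' .nil (by simpa using hx') (by simp) n₂ e₃)).1 rfl
  · obtain ⟨rfl, -⟩ : u₄ = x' ∧ True := by
      cases p with
      | nil => exact ⟨rfl, trivial⟩
      | cons h p => simp only [SimpleGraph.Walk.length_cons] at hp; omega
    have hsup : ∃ z, (z = u₁ ∨ z = u₂ ∨ z = u₃) ∧ R z := by
      by_contra! hcon
      refine hall fun z hz => ?_
      cases p with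
      | nil =>
        simp only [SimpleGraph.Walk.support_cons, SimpleGraph.Walk.support_nil, List.mem_cons,
          List.not_mem_nil, or_false] at hz
        rcases hz with rfl | rfl | rfl | rfl | rfl
        exacts [hx, hcon _ (by simp), hcon _ (by simp), hcon _ (by simp), hx']
      | cons h p => simp only [SimpleGraph.Walk.length_cons] at hp; omega
    have m₃ : R u₃ → u₃ = ρ₃ ∨ u₃ = ρ₄ := fun n₃ =>
      near' .nil (by simpa using hx') (by simp) n₃ e₄
    have m₂ : ¬ R u₃ → R u₂ → u₂ = ρ₃ ∨ u₂ = ρ₄ := fun n₃ n₂ =>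
      near' (.cons e₄.symm .nil) (by simp [hx', n₃]) (by simp) n₂ e₃
    by_cases n₁ : R u₁
    · have m₁ := near .nil (by simpa using hx) (by simp) n₁ e₁.symm
      by_cases n₃ : R u₃
      · exact (hfar u₁ u₃ m₁ (m₃ n₃)).1 (huniq _ _ _ n₁ n₃ e₂ e₃.symm)
      by_cases n₂ : R u₂
      · exact (hfar u₁ u₂ m₁ (m₂ n₃ n₂)).2 e₂
      · exact (hfar u₁ u₁ m₁ (near' (.cons e₄.symm (.cons e₃.symm .nil)) (by simp [hx', n₃, n₂])
          (by simp) n₁ e₂)).1 rfl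
    by_cases n₂ : R u₂
    · have k₂ := near (.cons e₁ .nil) (by simp [hx, n₁]) (by simp) n₂ e₂.symm
      by_cases n₃ : R u₃
      · exact (hfar u₂ u₃ k₂ (m₃ n₃)).2 e₃
      · exact (hfar u₂ u₂ k₂ (m₂ n₃ n₂)).1 rfl
    · have n₃ : R u₃ := by
        obtain ⟨z, rfl | rfl | rfl, hz⟩ := hsup
        exacts [absurd hz n₁, absurd hz n₂, hz]
      exact (hfar u₃ u₃ (near (.cons e₁ (.cons e₂ .nil)) (by simp [hx, n₁, n₂]) (by simp) n₃ e₃.symm)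
        (m₃ n₃)).1 rfl

theorem false_of_four_nonadjacent (hdiam : ∀ u v, ∃ p : G.Walk u v, p.length ≤ 4)
    (hdom : ∀ u, ¬ R u → ∃ r, R r ∧ G.Adj r u)
    (huniq : ∀ r r' m, R r → R r' → G.Adj r m → G.Adj r' m → r = r')
    (hwalk : ∀ b c y ρb ρc ρy (p : G.Walk b y), G.Adj b c → ¬ R c → (∀ z ∈ p.support, ¬ R z) →
      p.length ≤ 4 → R ρb → R ρc → R ρy → G.Adj ρb b → G.Adj ρc c → G.Adj ρy y → ρb ≠ ρc →
      ρy = ρb ∨ ρy = ρc)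
    (r : Fin 4 → V) (hr : ∀ i, R (r i)) (hne : ∀ i j, i < j → r i ≠ r j ∧ ¬ G.Adj (r i) (r j)) :
    False := by
  -- By `huniq` a vertex of `R` has at most one neighbour in `R`, so passing to such neighbours
  -- keeps nonadjacent vertices distinct and nonadjacent.
  have hfar : ∀ {r r' ρ ρ'}, R r → R r' → R ρ → R ρ' → r ≠ r' ∧ ¬ G.Adj r r' →
      (ρ = r ∨ G.Adj ρ r) → (ρ' = r' ∨ G.Adj ρ' r') → ρ ≠ ρ' ∧ ¬ G.Adj ρ ρ' := by
    rintro r r' ρ ρ' h h' hρ hρ' ⟨hn, hadj⟩ (rfl | e) (rfl | e')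
    · exact ⟨hn, hadj⟩
    · refine ⟨fun he => hadj (he ▸ e'), fun he => hn ?_⟩
      exact huniq _ _ _ h h' he e'.symm
    · refine ⟨fun he => hadj (he ▸ e.symm), fun he => hn ?_⟩
      exact huniq _ _ _ h h' e.symm he.symm
    · refine ⟨fun he => hn ?_, fun he => ?_⟩
      · subst he
        exact huniq _ _ _ h h' e.symm e'.symm
      · obtain rfl := huniq _ _ _ h hρ' e.symm he.symm
        exact hadj e'
  obtain ⟨x, w, ρ₁, ρ₂, hx, hw, hxw, h₁, h₂, h₁x, h₂w, h₁₂, g₁, g₂⟩ :=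
    exists_crossing_edge hdiam hdom huniq hwalk (hr 0) (hr 1) (hne 0 1 (by decide)).1
      (hne 0 1 (by decide)).2
  obtain ⟨x', w', ρ₃, ρ₄, hx', hw', hxw', h₃, h₄, h₃x, h₄w, h₃₄, g₃, g₄⟩ :=
    exists_crossing_edge hdiam hdom huniq hwalk (hr 2) (hr 3) (hne 2 3 (by decide)).1
      (hne 2 3 (by decide)).2
  refine false_of_two_crossing_edges hdiam huniq hwalk hx hw hxw h₁ h₂ h₁x h₂w h₁₂ hx' hw' hxw'
    h₃ h₄ h₃x h₄w h₃₄ ?_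
  rintro ρ ρ' (rfl | rfl) (rfl | rfl)
  · exact hfar (hr 0) (hr 2) h₁ h₃ (hne 0 2 (by decide)) g₁ g₃
  · exact hfar (hr 0) (hr 3) h₁ h₄ (hne 0 3 (by decide)) g₁ g₄
  · exact hfar (hr 1) (hr 2) h₂ h₃ (hne 1 2 (by decide)) g₂ g₃
  · exact hfar (hr 1) (hr 3) h₂ h₄ (hne 1 3 (by decide)) g₂ g₄

end Stars

/-! ### Rich vertices dominate when the H-graph is absent -/

section RichDomination

variable {V : Type*} {G : SimpleGraph V} {M n s : ℕ} {σ : ℕ → ℕ → V}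

theorem IsSegmentFamily.card_meeting_vertex_le (hσ : IsSegmentFamily G M n σ) {I : Finset ℕ}
    (hI : ∀ i ∈ I, i < M) (u : V) (hu : ∀ i ∈ I, ∃ h ≤ 4 * n, σ i h = u) : I.card ≤ 1 :=
  (hσ.card_meeting_le I hI {u} fun i hi => by simpa using hu i hi).trans (by simp)

/-- Unless `subdividedH 2 n` is contained in `G`, every vertex is on or next to the middle part of
at most two of the segments. -/
theorem IsSegmentFamily.card_near_le (hσ : IsSegmentFamily G M n σ) (hH : ¬ subdividedH 2 n ⊑ G)
    (u : V) {I : Finset ℕ} (hI : ∀ i ∈ I, i < M ∧ ((∃ h ≤ 4 * n, σ i h = u) ∨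
      ∃ h, n ≤ h ∧ h ≤ 3 * n ∧ G.Adj u (σ i h))) : I.card ≤ 2 := by
  classical
  have h1 := hσ.card_meeting_vertex_le (I := I.filter fun i => ∃ h ≤ 4 * n, σ i h = u)
    (fun i hi => (hI i (Finset.mem_filter.mp hi).1).1) u (fun i hi => (Finset.mem_filter.mp hi).2)
  have h2 : (I.filter fun i => ¬ ∃ h ≤ 4 * n, σ i h = u).card ≤ 1 := by
    by_contra hcon
    obtain ⟨i, hi, j, hj, hij⟩ := Finset.one_lt_card.mp (not_le.mp hcon)
    rw [Finset.mem_filter] at hi hj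
    obtain ⟨hiM, hi'⟩ := hI i hi.1
    obtain ⟨hjM, hj'⟩ := hI j hj.1
    obtain ⟨h, a1, a2, ha⟩ := hi'.resolve_left hi.2
    obtain ⟨k, b1, b2, hb⟩ := hj'.resolve_left hj.2
    exact hH (hσ.subdividedH_isContained hiM hjM hij ⟨a1, a2⟩ ⟨b1, b2⟩
      (fun x hx e => hi.2 ⟨x, hx, e⟩) (fun x hx e => hj.2 ⟨x, hx, e⟩) ha hb)
  have := Finset.card_filter_add_card_filter_not (s := I) fun i => ∃ h ≤ 4 * n, σ i h = u
  omega

theorem IsSegmentFamily.card_segmentsWithin_one_le (hσ : IsSegmentFamily G M n σ)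
    (hH : ¬ subdividedH 2 n ⊑ G) (u : V) : (segmentsWithin G M n σ 1 u).card ≤ 2 := by
  refine hσ.card_near_le hH u fun i hi => ?_
  obtain ⟨hiM, q, hq⟩ := mem_segmentsWithin.mp hi
  refine ⟨hiM, ?_⟩
  rcases Nat.lt_or_ge q.length 1 with h | h
  · exact Or.inl ⟨2 * n, by omega, (q.eq_of_length_eq_zero (by omega)).symm⟩
  · exact Or.inr ⟨2 * n, by omega, by omega, SimpleGraph.Walk.adj_of_length_eq_one (p := q) (by omega)⟩

/-- If `v` is rich, a segment whose middle part stays away from `v` but whose centre is at distance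
2 completes an H-graph. If not, the descent contradicts the bound at distance 1. -/
theorem IsSegmentFamily.card_segmentsWithin_two_le (hσ : IsSegmentFamily G M n σ)
    (hs : 3 * n + 20 ≤ s) (hH : ¬ subdividedH 2 n ⊑ G) (v : V) :
    (segmentsWithin G M n σ 2 v).card ≤ s * 2 + s + 1 := by
  classical
  by_contra! hcon
  by_cases hv : IsRich G s n v
  · set A := segmentsWithin G M n σ 2 v with hA
    set B := A.filter fun i => (∃ h ≤ 4 * n, σ i h = v) ∨
      ∃ h, n ≤ h ∧ h ≤ 3 * n ∧ G.Adj v (σ i h) with hB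
    have hBc : B.card ≤ 2 := hσ.card_near_le hH v fun i hi =>
      ⟨(mem_segmentsWithin.mp (Finset.mem_filter.mp hi).1).1, (Finset.mem_filter.mp hi).2⟩
    obtain ⟨i, hiA, hiB⟩ : ∃ i ∈ A, i ∉ B := Finset.exists_mem_notMem_of_card_lt_card (by omega)
    obtain ⟨hiM, q, hq⟩ := mem_segmentsWithin.mp hiA
    rw [hB, Finset.mem_filter, not_and] at hiB
    have hiB := hiB hiA
    push Not at hiB
    obtain ⟨hon, hnext⟩ := hiB
    obtain ⟨l₃, h₃, m₃⟩ := hσ.exists_isLeg_up (h := 2 * n) (k := n) hiM (by omega)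
    obtain ⟨l₄, h₄, m₄⟩ := hσ.exists_isLeg_down (h := 2 * n) (k := n) hiM (by omega) (by omega)
    obtain ⟨m, hvm, hmb⟩ : ∃ m, G.Adj v m ∧ G.Adj m (σ i (2 * n)) := by
      generalize hc : σ i (2 * n) = c at q
      rcases q with _ | ⟨e₁, _ | ⟨e₂, q⟩⟩
      · exact absurd hc (hon _ (by omega))
      · exact absurd (hc ▸ e₁) (hnext _ (by omega) (by omega))
      · cases q with
        | nil => exact ⟨_, e₁, e₂⟩
        | cons e₃ q => simp only [SimpleGraph.Walk.length_cons] at hq; omega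
    -- The vertex `m` may lie on the segment, but not in its middle part, to which both legs are
    -- confined.
    refine hH (hv.subdividedH_isContained (by omega) hvm hmb.symm (hon _ (by omega)).symm h₃ h₄
      ?_ ?_ ?_ ?_ ?_)
    · intro x hx hy
      obtain ⟨a, _, _, rfl⟩ := m₃ _ hx
      obtain ⟨b, _, _, e⟩ := m₄ _ hy
      have := (hσ.inj i hiM i hiM a (by omega) b (by omega) e).2
      omega
    · intro hx
      obtain ⟨a, _, _, e⟩ := m₃ _ hx
      exact hon a (by omega) e.symm
    · intro hx
      obtain ⟨a, _, _, e⟩ := m₄ _ hx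
      exact hon a (by omega) e.symm
    · intro hx
      obtain ⟨a, _, _, rfl⟩ := m₃ _ hx
      exact hnext a (by omega) (by omega) hvm
    · intro hx
      obtain ⟨a, _, _, rfl⟩ := m₄ _ hx
      exact hnext a (by omega) (by omega) hvm
  · obtain ⟨u', h'⟩ := hσ.exists_closer hv hcon
    have h1 := hσ.card_segmentsWithin_one_le hH u'
    have h0 := Finset.card_le_card (segmentsWithin_mono (G := G) (M := M) (n := n) (σ := σ) (u := u')
      (t := 0) (t' := 1) (by omega))
    simp only [Nat.add_one_sub_one, Nat.sub_self] at h'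
    omega

/-- The number of segments needed to find `subdividedH 2 n`. -/
def segmentsNeeded (s : ℕ) : ℕ :=
  s * (s * (s * 2 + s + 1) + s + 1) + s + 1 + 1 + 3 * (s * 2 + s + 1)

theorem IsSegmentFamily.exists_isRich_near (hσ : IsSegmentFamily G (segmentsNeeded s) n σ)
    (hG : G.ediam ≤ 4) (hs : 3 * n + 20 ≤ s) (hH : ¬ subdividedH 2 n ⊑ G) (u : V)
    (hu : ¬ IsRich G s n u) : ∃ r, IsRich G s n r ∧ G.Adj r u := by
  have h2 := hσ.card_segmentsWithin_two_le hs hH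
  -- This `N` lets a second descent, from distance 3, exceed the bound at distance 2. So `r` must be
  -- rich; the drop straight to distance 2, possible for nonadjacent `r`, is excluded at once.
  obtain ⟨r, hr⟩ := hσ.exists_closer hu (t := 4) (N := s * (s * 2 + s + 1) + s + 1) (by
    rw [segmentsWithin_eq_range (k := 4) hG, Finset.card_range, segmentsNeeded]
    omega)
  have hbig : s * 2 + s + 1 ≤ s * (s * 2 + s + 1) + s + 1 := by
    have := Nat.mul_le_mul_right (s * 2 + s + 1) (show 1 ≤ s by omega)
    omega
  rcases hr with ⟨hadj, hr⟩ | hr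
  · refine ⟨r, ?_, hadj.symm⟩
    by_contra hcon
    obtain ⟨u', ⟨-, h'⟩ | h'⟩ := hσ.exists_closer hcon hr
    · exact absurd (h2 u') (by simpa using h')
    · have h0 := Finset.card_le_card (segmentsWithin_mono (G := G) (M := segmentsNeeded s) (n := n)
        (σ := σ) (u := u') (t := 4 - 1 - 2) (t' := 2) (by omega))
      have := h2 u'
      omega
  · have := h2 r
    simp only [Nat.reduceSub] at hr
    omega

theorem subdividedH_isContained_of_isPathSeq (hG : G.ediam ≤ 4) (hs : 3 * n + 20 ≤ s) {p : ℕ → V}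
    (hp : IsPathSeq G (segmentsNeeded s * (4 * n + 1)) p) : subdividedH 2 n ⊑ G := by
  classical
  by_contra hH
  have hσ := hp.isSegmentFamily
  set σ : ℕ → ℕ → V := fun i h => p (i * (4 * n + 1) + h) with hσdef
  have hdom := hσ.exists_isRich_near hG hs hH
  -- Some segment centre is at distance more than 2 from all of `T`; a rich vertex at or next to
  -- that centre is then neither in `T` nor adjacent to it.
  have hmore : ∀ T : Finset V, T.card ≤ 3 → ∃ r, IsRich G s n r ∧
      ∀ t ∈ T, t ≠ r ∧ ¬ G.Adj t r := by
    intro T hT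
    have hcard : (T.biUnion fun t => segmentsWithin G (segmentsNeeded s) n σ 2 t).card <
        (Finset.range (segmentsNeeded s)).card := by
      refine (Finset.card_biUnion_le_card_mul _ _ _ fun t _ =>
        hσ.card_segmentsWithin_two_le hs hH t).trans_lt ?_
      have := Nat.mul_le_mul_right (s * 2 + s + 1) hT
      rw [Finset.card_range, segmentsNeeded]
      omega
    obtain ⟨i, hi, hiT⟩ := Finset.exists_mem_notMem_of_card_lt_card hcard
    rw [Finset.mem_range] at hi
    have hfar : ∀ t ∈ T, ∀ q : G.Walk t (σ i (2 * n)), 2 < q.length := by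
      intro t ht q
      by_contra! hq
      exact hiT (Finset.mem_biUnion.mpr ⟨t, ht, mem_segmentsWithin.mpr ⟨hi, q, hq⟩⟩)
    obtain ⟨r, hr, q, hq⟩ : ∃ r, IsRich G s n r ∧ ∃ q : G.Walk r (σ i (2 * n)), q.length ≤ 1 := by
      by_cases h : IsRich G s n (σ i (2 * n))
      · exact ⟨_, h, .nil, by simp⟩
      · obtain ⟨r, hr, hadj⟩ := hdom _ h
        exact ⟨r, hr, .cons hadj .nil, by simp⟩
    refine ⟨r, hr, fun t ht => ⟨?_, fun hadj => ?_⟩⟩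
    · rintro rfl
      have := hfar t ht q
      omega
    · have := hfar t ht (.cons hadj q)
      rw [SimpleGraph.Walk.length_cons] at this
      omega
  obtain ⟨r₀, h₀, -⟩ := hmore ∅ (by simp)
  obtain ⟨r₁, h₁, a₁⟩ := hmore {r₀} (by simp)
  obtain ⟨r₂, h₂, a₂⟩ := hmore {r₀, r₁} (Finset.card_le_two.trans (by omega))
  obtain ⟨r₃, h₃, a₃⟩ := hmore {r₀, r₁, r₂} Finset.card_le_three
  refine false_of_four_nonadjacent (R := IsRich G s n) (exists_walk_length_le (k := 4) hG) hdom
    (fun r r' m hr hr' h h' => hr.eq_of_common_neighbor (by omega) hH hr' h h')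
    (fun b c y ρb ρc ρy p hbc hc hp hl hb' hc' hy' eb ec ey hne =>
      rich_eq_or_eq_of_walk hs hH hbc hc p hp hl hb' hc' hy' eb ec ey hne)
    ![r₀, r₁, r₂, r₃] ?_ ?_
  · intro i
    fin_cases i
    exacts [h₀, h₁, h₂, h₃]
  · intro i j hij
    fin_cases i <;> fin_cases j <;> first | exact absurd hij (by decide) | skip
    exacts [a₁ r₀ (by simp), a₂ r₀ (by simp), a₃ r₀ (by simp), a₂ r₁ (by simp), a₃ r₁ (by simp),
      a₃ r₂ (by simp)]

end RichDomination

/-! ### The characterisation -/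

theorem theorem2 {W : Type*} [Finite W] (F : SimpleGraph W) :
    (∃ c : ℕ, ∀ (V : Type) [Fintype V] (G : SimpleGraph V),
        F.Free G → G.ediam ≤ 4 → treedepth G ≤ c) ↔
      ((∃ (k : ℕ) (len : Fin k → ℕ),
          3 ≤ k ∧ (∀ i, 1 ≤ len i) ∧ F ⊑ subdividedStar k len) ∨
        ∃ l : ℕ, 1 ≤ l ∧ F ⊑ subdividedH 2 l) := by
  constructor
  · rintro ⟨c, hc⟩
    exact isContained_of_forall_treedepth_le hc
  · rintro (⟨k, len, -, -, hF⟩ | ⟨n, -, hF⟩)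
    · obtain ⟨n, hn⟩ : ∃ n, ∀ i, len i ≤ n :=
        ⟨Finset.univ.sup len, fun i => Finset.le_sup (Finset.mem_univ i)⟩
      refine ⟨(segmentBound (k * n) 4 + 1) * (4 * n + 1), fun V _ G hfree hG => ?_⟩
      refine treedepth_le_of_forall_not_isPathSeq fun p hp => hfree ?_
      exact hF.trans (subdividedStar_isContained_of_isPathSeq hn hG (hp.mono (Nat.le_succ _)))
    · refine ⟨segmentsNeeded (3 * n + 20) * (4 * n + 1), fun V _ G hfree hG => ?_⟩
      refine treedepth_le_of_forall_not_isPathSeq fun p hp => hfree ?_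
      exact hF.trans (subdividedH_isContained_of_isPathSeq hG le_rfl (hp.mono (Nat.le_succ _)))
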